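/- Let $\mathcal X$ be a measurable space, let $A=\mathcal Y=\{0,1\}$, and let $\mathcal H$ be a nonempty class of classifiers $h:\mathcal X\to\{0,1\}$ of VC dimension $d<\infty$. For a probability measure $\mathbb P$ on $\mathcal X\times A\times\mathcal Y$ with $P_0=\mathbb P(A=0)\in(0,\tfrac12]$ put $$\mathcal R(h)=\mathbb P(h(X)\ne Y),\qquad \mathcal D^{par}(h)=\bigl|\mathbb P(h(X)=1\mid A=0)-\mathbb P(h(X)=1\mid A=1)\bigr| .$$ For a dataset $S=((x_i,a_i,y_i))_{i=1}^n$ let $$\widehat{\mathcal R}_S(h)=\frac1n\sum_{i}\mathbb 1\{h(x_i)\ne y_i\},\qquad \widehat{\mathcal D}_S(h)=\left|\frac{\sum_i\mathbb 1\{h(x_i)=1,a_i=0\}}{\sum_i\mathbb 1\{a_i=0\}}-\frac{\sum_i\mathbb 1\{h(x_i)=1,a_i=1\}}{\sum_i\mathbb 1\{a_i=1\}}\right|$$ with $0/0=0$. Let $\alpha\in[0,\tfrac12)$, $\delta\in(0,1)$, $\Delta^{par}=\dfrac{2\alpha}{P_0/3+\alpha}$, and (with $d\log(c/d)=0$ if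 $d=0$) $$r_n=\sqrt{\frac{8d\log(en/d)+2\log(16/\delta)}{n}},\qquad f_n=\sqrt{\frac{2d\log(2en/d)+2\log(96/\delta)}{(1-\alpha)P_0n}} .$$ Let $\mathcal H_1(S)$ be the set of $h\in\mathcal H$ with $\widehat{\mathcal R}_S(h)-\min_{\mathcal H}\widehat{\mathcal R}_S\le 3\alpha+4r_n$, and $\mathcal H_2(S)$ the set of $h\in\mathcal H$ with $\widehat{\mathcal D}_S(h)-\min_{\mathcal H}\widehat{\mathcal D}_S\le 2\Delta^{par}+32f_n$. A component-wise learner $\mathcal L$ (for $\mathcal H,\alpha,P_0,\delta$) is a map from datasets of arbitrary size to $\mathcal H$ with $\mathcal L(S)\in\mathcal H_1(S)\cap\mathcal H_2(S)$ whenever this intersection is nonempty. A malicious adversary of power $\alpha$ acts as follows: a clean dataset of size $n$ is drawn i.i.d. from $\mathbb P$; each index is marked independently (of the other indices and of the data) with probability $\alpha$; knowing the clean data, the marks, $\mathbb P$ and $\mathcal L$, and possibly using independent randomness, the adversary outputs a dataset $S^p$ of size $n$ that agrees with the clean one at every unmarked index. Component-wise learners exist, and for every component-wise learner $\mathcal L$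 the following holds. Let $\mathbb P$ be as above, and suppose that every $h\in\mathcal H$ is measurable and that, for all $m$ and all $b\in\{0,1\}^m$, the set $\{x\in\mathcal X^m:\exists h\in\mathcal H,\ h(x_i)=b_i\ \forall i\}$ is measurable up to a null set of the $m$-fold product of the law of $X$ (this holds, for example, if $\mathcal H$ is countable). Suppose that some $h^*\in\mathcal H$ satisfies $\mathcal R(h^*)\le\mathcal R(h)$ and $\mathcal D^{par}(h^*)\le\mathcal D^{par}(h)$ for all $h\in\mathcal H$. Then for every malicious adversary of power $\alpha$ and every $$n\ge\max\left\{\frac{8\log(16/\delta)}{(1-\alpha)P_0},\ \frac{12\log(12/\delta)}{\alpha},\ \frac d2\right\}$$ (the middle term being omitted if $\alpha=0$), with probability at least $1-\delta$ over the clean data, the marks and the randomness of the adversary, simultaneously $$\mathcal R(\mathcal L(S^p))-\mathcal R(h^*)\le 6\alpha+8r_n=6\alpha+\widetilde{\mathcal O}\Bigl(\sqrt{d/n}\Bigr),$$ $$\mathcal D^{par}(\mathcal L(S^p))-\mathcal D^{par}(h^*)\le 4\Delta^{par}+64f_n=4\Delta^{par}+\widetilde{\mathcal O}\Bigl(\sqrt{d/(P_0n)}\Bigr),$$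 where for $d\ge1$ the notation $\widetilde{\mathcal O}$ hides constants and factors logarithmic in $n/d$ and $1/\delta$. -/

import Mathlib

open MeasureTheory ProbabilityTheory

noncomputable section

namespace FairLearning

/-! ### Data, classifiers, risk and demographic parity

In both `Bool` components `false` stands for `0` and `true` for `1`. -/

/-- A labelled example `(x, a, y)`: input, protected attribute, label. -/
abbrev DataPoint (X : Type*) := X × Bool × Bool

/-- A dataset of size `n`. -/
abbrev Dataset (X : Type*) (n : ℕ) := Fin n → DataPoint X

section Population

variable {X : Type*} [MeasurableSpace X]

/-- The probability `P_a = ℙ(A = a)` of the protected group `a`. -/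
def groupProb (P : Measure (DataPoint X)) (a : Bool) : ℝ :=
  P.real {z | z.2.1 = a}

/-- The risk `ℛ(h, ℙ) = ℙ(h(X) ≠ Y)`. -/
def risk (P : Measure (DataPoint X)) (h : X → Bool) : ℝ :=
  P.real {z | h z.1 ≠ z.2.2}

/-- The conditional acceptance probability `ℙ(h(X) = 1 | A = a)`. -/
def acceptRate (P : Measure (DataPoint X)) (h : X → Bool) (a : Bool) : ℝ :=
  (P[|{z | z.2.1 = a}]).real {z | h z.1 = true}

/-- The demographic parity deviation (mean difference score). -/
def parityDev (P : Measure (DataPoint X)) (h : X → Bool) : ℝ :=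
  |acceptRate P h false - acceptRate P h true|

end Population

section Empirical

variable {X : Type*} {n : ℕ}

/-- The empirical risk of `h` on the dataset `S`. -/
def empRisk (S : Dataset X n) (h : X → Bool) : ℝ :=
  (Finset.univ.filter fun i => h (S i).1 ≠ (S i).2.2).card / (n : ℝ)

/-- The empirical acceptance rate of `h` in group `a`; it is `0` if the group is absent. -/
def empAcceptRate (S : Dataset X n) (h : X → Bool) (a : Bool) : ℝ :=
  (Finset.univ.filter fun i => h (S i).1 = true ∧ (S i).2.1 = a).card /
    ((Finset.univ.filter fun i => (S i).2.1 = a).card : ℝ)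

/-- The empirical demographic parity deviation of `h` on the dataset `S`. -/
def empParityDev (S : Dataset X n) (h : X → Bool) : ℝ :=
  |empAcceptRate S h false - empAcceptRate S h true|

end Empirical

/-! ### Hypothesis classes -/

section Classes

variable {X : Type*}

/-- `H` shatters the finite set `s`: every labelling of `s` is realized by a member of `H`. -/
def Shatters (H : Set (X → Bool)) (s : Finset X) : Prop :=
  ∀ t ⊆ s, ∃ h ∈ H, ∀ x ∈ s, h x = true ↔ x ∈ t

/-- The VC dimension of `H`: the supremum of the sizes of the finite sets shattered by `H`. -/
def vcDim (H : Set (X → Bool)) : ℕ∞ :=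
  ⨆ (s : Finset X) (_ : Shatters H s), (s.card : ℕ∞)

/-- The measurability requirement on a hypothesis class, with `ν` the law of the inputs: the
hypotheses are measurable, and for every pattern `b ∈ {0,1}^m` the set of those input tuples
`(x₁, …, x_m)` on which some hypothesis of the class takes the values `b` is measurable (up to
null sets). It holds, for instance, for countable classes of measurable functions. It makes
suprema over the class of functions of empirical quantities measurable; for a class that is not
regular in this sense, finite VC dimension does not imply uniform convergence. -/
structure RegularClass [MeasurableSpace X] (H : Set (X → Bool)) (ν : Measure X) : Prop where
  measurable : ∀ h ∈ H, Measurable h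
  trace : ∀ (m : ℕ) (b : Fin m → Bool),
    NullMeasurableSet {x : Fin m → X | ∃ h ∈ H, ∀ i, h (x i) = b i} (Measure.pi fun _ => ν)

end Classes

/-! ### The malicious adversary -/

/-- A malicious adversary: a randomized map that takes a clean dataset and the set of marked
indices (those `i` with `marked i = true`) and returns a dataset of the same size that agrees with
the clean one at all unmarked indices. The randomness is a random seed. -/
structure MaliciousAdversary (X : Type*) where
  Seed : Type*
  [seedSpace : MeasurableSpace Seed]
  seedLaw : Measure Seed
  [isProbability : IsProbabilityMeasure seedLaw]
  corrupt : ∀ {n : ℕ}, Dataset X n → (Fin n → Bool) → Seed → Dataset X n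
  corrupt_unmarked : ∀ {n : ℕ} (clean : Dataset X n) (marked : Fin n → Bool) (r : Seed) (i : Fin n),
    marked i = false → corrupt clean marked r i = clean i

attribute [instance] MaliciousAdversary.seedSpace MaliciousAdversary.isProbability

/-- The law of a single mark: marked with probability `α`. -/
def markLaw (α : ℝ) : Measure Bool :=
  ENNReal.ofReal α • Measure.dirac true + ENNReal.ofReal (1 - α) • Measure.dirac false

namespace MaliciousAdversary

variable {X : Type*} [MeasurableSpace X]

/-- The outcomes of the data generation: clean dataset, marks, seed of the adversary. -/
abbrev Outcome (𝒜 : MaliciousAdversary X) (n : ℕ) :=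
  Dataset X n × (Fin n → Bool) × 𝒜.Seed

/-- The law of the whole data generation: the clean points are i.i.d. from `P`, every index is
marked independently with probability `α`, and the seed is independent of both. -/
def law (𝒜 : MaliciousAdversary X) (P : Measure (DataPoint X)) (α : ℝ) (n : ℕ) :
    Measure (𝒜.Outcome n) :=
  (Measure.pi fun _ : Fin n => P).prod ((Measure.pi fun _ : Fin n => markLaw α).prod 𝒜.seedLaw)

/-- The corrupted dataset that is passed on to the learner. -/
def corrupted (𝒜 : MaliciousAdversary X) {n : ℕ} (ω : 𝒜.Outcome n) : Dataset X n :=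
  𝒜.corrupt ω.1 ω.2.1 ω.2.2

end MaliciousAdversary

/-! ### The component-wise learner -/

/-- The irreducible term `Δ^par = 2α / (P₀/3 + α)`. -/
def deltaPar (α p₀ : ℝ) : ℝ := 2 * α / (p₀ / 3 + α)

/-- The statistical error term `√((8 d log(en/d) + 2 log(16/δ)) / n)` of the risk
(with `0 · log(en/0) = 0` for `d = 0`). -/
def riskErr (d : ℕ) (δ : ℝ) (n : ℕ) : ℝ :=
  √((8 * d * Real.log (Real.exp 1 * n / d) + 2 * Real.log (16 / δ)) / n)

/-- The statistical error term `√((2 d log(2en/d) + 2 log(96/δ)) / ((1-α) P₀ n))` of the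
demographic parity deviation (with `0 · log(2en/0) = 0` for `d = 0`). -/
def parityErr (d : ℕ) (α p₀ δ : ℝ) (n : ℕ) : ℝ :=
  √((2 * d * Real.log (2 * Real.exp 1 * n / d) + 2 * Real.log (96 / δ)) / ((1 - α) * p₀ * n))

section Learner

variable {X : Type*}

/-- The hypotheses whose empirical risk is nearly minimal over `H`. -/
def nearOptRisk (H : Set (X → Bool)) (d : ℕ) (α δ : ℝ) {n : ℕ} (S : Dataset X n) :
    Set (X → Bool) :=
  {h | h ∈ H ∧ ∃ hr ∈ H, IsMinOn (empRisk S) H hr ∧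
    empRisk S h - empRisk S hr ≤ 3 * α + 4 * riskErr d δ n}

/-- The hypotheses whose empirical demographic parity deviation is nearly minimal over `H`. -/
def nearOptParity (H : Set (X → Bool)) (d : ℕ) (α p₀ δ : ℝ) {n : ℕ} (S : Dataset X n) :
    Set (X → Bool) :=
  {h | h ∈ H ∧ ∃ hp ∈ H, IsMinOn (empParityDev S) H hp ∧
    empParityDev S h - empParityDev S hp ≤ 2 * deltaPar α p₀ + 32 * parityErr d α p₀ δ n}

/-- A learner with hypothesis class `H`: it maps datasets of arbitrary size to members of `H`. -/
abbrev Learner (H : Set (X → Bool)) := ∀ n : ℕ, Dataset X n → H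

/-- A component-wise learner returns some hypothesis that is nearly optimal in both empirical
objectives whenever there is one (and an arbitrary member of `H` otherwise). -/
def IsComponentWise (H : Set (X → Bool)) (d : ℕ) (α p₀ δ : ℝ) (L : Learner H) : Prop :=
  ∀ (n : ℕ) (S : Dataset X n),
    (nearOptRisk H d α δ S ∩ nearOptParity H d α p₀ δ S).Nonempty →
      (L n S : X → Bool) ∈ nearOptRisk H d α δ S ∩ nearOptParity H d α p₀ δ S

end Learner

end FairLearning

end

namespace FairLearning

/-! ### The growth function of a class of finite VC dimension -/

section Growth

variable {X : Type*}

/-! The adversary is disposed of by a deterministic argument on a good event that concerns only the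
clean points and the marks. Paired with their marks, the clean points form an i.i.d. sample from
`P.prod (markLaw α)`. On the good event at most `3/2 α n` points are marked, each group keeps at
least `p₀ n / 4` unmarked points, the clean error frequencies of all hypotheses are within `2 *
riskErr` of the risks, and the acceptance frequencies among the unmarked points of each group are
within `8 * parityErr` of the conditional probabilities. Whatever is then written at the marked
indices, the empirical risk stays within `3/2 α + 2 * riskErr` of the risk (`abs_empRisk_sub_le`)
and the empirical parity deviation within `deltaPar + 16 * parityErr` of the true one
(`abs_empParityDev_sub_le`), uniformly over `H`. With such errors `ε`, `hstar` is empirically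
`2ε`-optimal in both objectives, so the learner's intersection is nonempty and its output is
`4ε`-optimal in both (`IsComponentWise.sub_le`).

The counts of the good event are Chernoff bounds; the two uniform deviations come from one
symmetrization bound, `measure_le_of_ghost_deviation`. Errors and acceptances are both counted as
points of a set `W` where `h` differs from a target (`miss`): `W` is everything for the risk, and an
unmarked group with target `false` for parity. Random exchanges between a sample and a ghost sample
turn a difference of counts into a random signed sum whose variance is at most the number of pairs
meeting `W` (`spread`). Hoeffding's inequality and the Sauer-Shelah bound on `2n` points then
control all hypotheses at once. Since `spread` is unchanged by exchanges and comparable to the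
number of hits of `W`, conditional frequencies can be treated without conditioning on which indices
fall in a group. -/

lemma Shatters.card_le_of_vcDim_eq {H : Set (X → Bool)} {d : ℕ} (hd : vcDim H = d)
    {s : Finset X} (hs : Shatters H s) : s.card ≤ d := by
  have h : (s.card : ℕ∞) ≤ vcDim H := le_iSup₂_of_le s hs le_rfl
  rw [hd] at h
  exact_mod_cast h

/-- The Sauer-Shelah bound on the number of patterns that a class of finite VC dimension realizes
on a tuple of points. -/
lemma ncard_patterns_le {ι : Type*} [Fintype ι] {H : Set (X → Bool)} {d : ℕ}
    (hd : vcDim H = d) (u : ι → X) :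
    {β : ι → Bool | ∃ h ∈ H, ∀ i, h (u i) = β i}.ncard
      ≤ ∑ k ∈ Finset.Iic d, (Fintype.card ι).choose k := by
  classical
  set T : Finset (ι → Bool) := (Set.toFinite {β : ι → Bool | ∃ h ∈ H, ∀ i, h (u i) = β i}).toFinset
    with hT
  have hmem : ∀ β, β ∈ T ↔ ∃ h ∈ H, ∀ i, h (u i) = β i := by simp [hT]
  let F : (ι → Bool) → Finset ι := fun β => Finset.univ.filter fun i => β i = true
  have hF : Function.Injective F := by
    intro β γ h
    funext i
    have := Finset.ext_iff.1 h i
    simp only [F, Finset.mem_filter, Finset.mem_univ, true_and] at this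
    exact Bool.eq_iff_iff.2 this
  have hcard : {β : ι → Bool | ∃ h ∈ H, ∀ i, h (u i) = β i}.ncard = (T.image F).card := by
    rw [Finset.card_image_of_injective _ hF, Set.ncard_eq_toFinset_card _ (Set.toFinite _)]
  rw [hcard]
  refine (Finset.card_le_card_shatterer _).trans (Finset.card_shatterer_le_sum_vcDim.trans ?_)
  refine Finset.sum_le_sum_of_subset (Finset.Iic_subset_Iic.2 ?_)
  refine Finset.sup_le fun s hs => ?_
  rw [Finset.mem_shatterer] at hs
  have key : ∀ t ⊆ s, ∃ h ∈ H, ∀ i ∈ s, h (u i) = true ↔ i ∈ t := by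
    intro t ht
    obtain ⟨v, hv, hvt⟩ := hs ht
    obtain ⟨β, hβ, rfl⟩ := Finset.mem_image.1 hv
    obtain ⟨h, hh, hβ⟩ := (hmem β).1 hβ
    refine ⟨h, hh, fun i hi => ?_⟩
    rw [← hvt, hβ]
    simp [F, hi]
  -- Repeated points cannot be separated by any hypothesis, so a shattered set of indices carries
  -- distinct points and has a shattered image of the same size.
  have hinj : Set.InjOn u s := by
    intro i hi j hj hij
    obtain ⟨h, -, hh⟩ := key {i} (by simpa using hi)
    have h1 := (hh i hi).2 (by simp)
    have h2 := (hh j hj).1 (hij ▸ h1)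
    simpa using (Finset.mem_singleton.1 h2).symm
  rw [← Finset.card_image_of_injOn hinj]
  refine Shatters.card_le_of_vcDim_eq hd fun t ht => ?_
  obtain ⟨h, hh, hst⟩ := key (s.filter fun i => u i ∈ t) (Finset.filter_subset _ _)
  refine ⟨h, hh, fun x hx => ?_⟩
  obtain ⟨i, hi, rfl⟩ := Finset.mem_image.1 hx
  rw [hst i hi]
  simp [hi]

/-- With `x = d / m ≤ 1`, multiplying by `x ^ d` is at most weighting the `k`-th term by `x ^ k`;
the binomial theorem then gives `(1 + x) ^ m ≤ exp d`. For `d = 0` the base is a division by zero,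
but its power is `1`. -/
lemma sum_choose_le {d m : ℕ} (hdm : d ≤ m) :
    ((∑ k ∈ Finset.Iic d, m.choose k : ℕ) : ℝ) ≤ (Real.exp 1 * m / d) ^ d := by
  rcases Nat.eq_zero_or_pos d with rfl | hd
  · have : Finset.Iic 0 = ({0} : Finset ℕ) := by ext; simp
    simp [this]
  have hd' : (0 : ℝ) < d := by exact_mod_cast hd
  have hm' : (0 : ℝ) < m := by exact_mod_cast hd.trans_le hdm
  set x : ℝ := d / m with hx
  have hx0 : 0 < x := by positivity
  have hx1 : x ≤ 1 := by rw [hx, div_le_one hm']; exact_mod_cast hdm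
  have h1 : x ^ d * ((∑ k ∈ Finset.Iic d, m.choose k : ℕ) : ℝ) ≤ Real.exp 1 ^ d := by
    calc x ^ d * ((∑ k ∈ Finset.Iic d, m.choose k : ℕ) : ℝ)
        = ∑ k ∈ Finset.Iic d, x ^ d * (m.choose k : ℝ) := by push_cast; rw [Finset.mul_sum]
      _ ≤ ∑ k ∈ Finset.Iic d, x ^ k * (m.choose k : ℝ) := by
          refine Finset.sum_le_sum fun k hk => ?_
          exact mul_le_mul_of_nonneg_right
            (pow_le_pow_of_le_one hx0.le hx1 (Finset.mem_Iic.1 hk)) (by positivity)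
      _ ≤ ∑ k ∈ Finset.range (m + 1), x ^ k * (m.choose k : ℝ) := by
          refine Finset.sum_le_sum_of_subset_of_nonneg ?_ fun k _ _ => by positivity
          intro k hk
          simp only [Finset.mem_Iic, Finset.mem_range] at *
          omega
      _ = (x + 1) ^ m := by rw [add_pow]; simp
      _ ≤ Real.exp x ^ m := by gcongr; exact Real.add_one_le_exp x
      _ = Real.exp 1 ^ d := by
          rw [← Real.exp_nat_mul, ← Real.exp_nat_mul, hx]
          congr 1
          field_simp
  have h2 : (Real.exp 1 * m / d) ^ d = Real.exp 1 ^ d / x ^ d := by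
    rw [← div_pow, hx]
    congr 1
    field_simp
  rw [h2, le_div_iff₀ (by positivity), mul_comm]
  exact h1

end Growth

/-! ### Random signs -/

/-- The sign encoded by a bit. -/
def sgn (b : Bool) : ℝ := if b then -1 else 1

/-- Hoeffding's inequality for random signs, as a counting bound. -/
lemma card_signs_le {n : ℕ} (c : Fin n → ℝ) {N K : ℝ} (hK : 0 ≤ K) (hN : ∑ i, c i ^ 2 ≤ N) :
    ((Finset.univ.filter fun σ : Fin n → Bool => N * K < (∑ i, sgn (σ i) * c i) ^ 2).card : ℝ)
      ≤ 2 ^ n * (2 * Real.exp (-K / 2)) := by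
  classical
  have hV0 : 0 ≤ ∑ i, c i ^ 2 := Finset.sum_nonneg fun i _ => sq_nonneg _
  have hN0 : 0 ≤ N := hV0.trans hN
  -- For `N = 0` all coefficients vanish, and the event is empty because its inequality is strict.
  rcases hN0.eq_or_lt with hN' | hNpos
  · have hc : ∀ i, c i = 0 := by
      have := (Finset.sum_eq_zero_iff_of_nonneg fun i _ => sq_nonneg (c i)).1
        (le_antisymm (hN.trans hN'.symm.le) hV0)
      exact fun i => by simpa using this i (Finset.mem_univ i)
    have : (Finset.univ.filter fun σ : Fin n → Bool => N * K < (∑ i, sgn (σ i) * c i) ^ 2) = ∅ := by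
      simp [hc, ← hN']
    rw [this]
    simp only [Finset.card_empty, Nat.cast_zero]
    positivity
  -- The Chernoff parameter: on the event `|l S| ≥ K`, while the moment bound is `exp (l² N / 2) =
  -- exp (K / 2)`, leaving `exp (-K / 2)`.
  set l : ℝ := √(K / N) with hl
  have hl2 : l ^ 2 = K / N := Real.sq_sqrt (by positivity)
  have hsum : ∀ b : ℝ, ∑ σ : Fin n → Bool, Real.exp (b * ∑ i, sgn (σ i) * c i)
      ≤ 2 ^ n * Real.exp (b ^ 2 * N / 2) := by
    intro b
    calc ∑ σ : Fin n → Bool, Real.exp (b * ∑ i, sgn (σ i) * c i)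
        = ∑ σ : Fin n → Bool, ∏ i, Real.exp (b * (sgn (σ i) * c i)) := by
          simp_rw [Finset.mul_sum, Real.exp_sum]
      _ = ∏ i, ∑ s : Bool, Real.exp (b * (sgn s * c i)) := by
          rw [Finset.prod_univ_sum, Fintype.piFinset_univ]
      _ = ∏ i, (2 * Real.cosh (b * c i)) := by
          refine Finset.prod_congr rfl fun i _ => ?_
          rw [Real.cosh_eq]
          simp [sgn]
          ring_nf
      _ ≤ ∏ i, (2 * Real.exp ((b * c i) ^ 2 / 2)) := by
          refine Finset.prod_le_prod (fun i _ => by positivity) fun i _ => ?_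
          gcongr
          exact Real.cosh_le_exp_half_sq _
      _ = 2 ^ n * Real.exp (b ^ 2 * (∑ i, c i ^ 2) / 2) := by
          rw [Finset.prod_mul_distrib, ← Real.exp_sum]
          simp [Finset.mul_sum, Finset.sum_div, mul_pow]
      _ ≤ _ := by gcongr
  set B := Finset.univ.filter fun σ : Fin n → Bool => N * K < (∑ i, sgn (σ i) * c i) ^ 2 with hB
  have hpt : ∀ σ ∈ B, Real.exp K ≤ Real.exp (l * ∑ i, sgn (σ i) * c i)
      + Real.exp (-l * ∑ i, sgn (σ i) * c i) := by
    intro σ hσ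
    have hσ' : N * K < (∑ i, sgn (σ i) * c i) ^ 2 := (Finset.mem_filter.1 hσ).2
    set S := ∑ i, sgn (σ i) * c i
    have hlS : K ^ 2 ≤ (l * S) ^ 2 := by
      rw [mul_pow, hl2]
      calc K ^ 2 = K / N * (N * K) := by field_simp
        _ ≤ _ := by gcongr
    have habs : K ≤ |l * S| := by
      rw [← abs_of_nonneg hK]
      exact sq_le_sq.1 hlS
    rcases le_abs.1 habs with h | h
    · exact (Real.exp_le_exp.2 h).trans (le_add_of_nonneg_right (Real.exp_pos _).le)
    · rw [← neg_mul] at h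
      exact (Real.exp_le_exp.2 h).trans (le_add_of_nonneg_left (Real.exp_pos _).le)
  have hcount : (B.card : ℝ) * Real.exp K ≤ 2 * (2 ^ n * Real.exp (K / 2)) := by
    calc (B.card : ℝ) * Real.exp K = ∑ σ ∈ B, Real.exp K := by simp
      _ ≤ ∑ σ ∈ B, (Real.exp (l * ∑ i, sgn (σ i) * c i)
          + Real.exp (-l * ∑ i, sgn (σ i) * c i)) := Finset.sum_le_sum hpt
      _ ≤ ∑ σ : Fin n → Bool, (Real.exp (l * ∑ i, sgn (σ i) * c i)
          + Real.exp (-l * ∑ i, sgn (σ i) * c i)) :=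
          Finset.sum_le_sum_of_subset_of_nonneg (Finset.subset_univ _)
            fun _ _ _ => by positivity
      _ ≤ 2 ^ n * Real.exp (l ^ 2 * N / 2) + 2 ^ n * Real.exp ((-l) ^ 2 * N / 2) := by
          rw [Finset.sum_add_distrib]
          exact add_le_add (hsum l) (hsum (-l))
      _ = 2 * (2 ^ n * Real.exp (K / 2)) := by
          rw [neg_sq, hl2, div_mul_cancel₀ _ hNpos.ne']
          ring
  have hexp : Real.exp (-K / 2) * Real.exp K = Real.exp (K / 2) := by
    rw [← Real.exp_add]
    ring_nf
  rw [← mul_le_mul_iff_left₀ (Real.exp_pos K)]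
  calc _ ≤ _ := hcount
    _ = _ := by rw [← hexp]; ring

/-! ### Symmetrization -/

section Symmetrization

variable {Ω : Type*} [MeasurableSpace Ω] {n : ℕ}

/-- Exchange the coordinates marked by `σ` between a sample and a ghost sample. -/
def swapAt (σ : Fin n → Bool) (p : (Fin n → Ω) × (Fin n → Ω)) : (Fin n → Ω) × (Fin n → Ω) :=
  (fun i => if σ i then p.2 i else p.1 i, fun i => if σ i then p.1 i else p.2 i)

/-- After regrouping into `n` independent pairs, the map acts on each pair either as the identity or
as the swap of two equally distributed points. -/
lemma measurePreserving_swapAt (Q : Measure Ω) [IsProbabilityMeasure Q] (σ : Fin n → Bool) :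
    MeasurePreserving (swapAt σ)
      ((Measure.pi fun _ : Fin n => Q).prod (Measure.pi fun _ : Fin n => Q))
      ((Measure.pi fun _ : Fin n => Q).prod (Measure.pi fun _ : Fin n => Q)) := by
  have h1 := measurePreserving_arrowProdEquivProdArrow Ω Ω (Fin n) (fun _ => Q) (fun _ => Q)
  have h2 : MeasurePreserving (fun (a : Fin n → Ω × Ω) i => if σ i then (a i).swap else a i)
      (Measure.pi fun _ => Q.prod Q) (Measure.pi fun _ => Q.prod Q) := by
    refine measurePreserving_pi (f := fun i (z : Ω × Ω) => if σ i then z.swap else z)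
      (fun _ => Q.prod Q) (fun _ => Q.prod Q) fun i => ?_
    rcases h : σ i with _ | _
    · simpa using! MeasurePreserving.id (Q.prod Q)
    · simpa using (Measure.measurePreserving_swap (μ := Q) (ν := Q))
  convert (h1.comp h2).comp h1.symm using 1
  funext p
  ext i
  · simp only [swapAt, Function.comp, MeasurableEquiv.arrowProdEquivProdArrow]
    by_cases h : σ i = true <;> simp [h, Equiv.arrowProdEquivProdArrow]
  · simp only [swapAt, Function.comp, MeasurableEquiv.arrowProdEquivProdArrow]
    by_cases h : σ i = true <;> simp [h, Equiv.arrowProdEquivProdArrow]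

open Classical in
/-- An event that, at every double sample, is preserved by few exchanges has small probability. -/
lemma prod_measure_le_of_card_swapAt_le (Q : Measure Ω) [IsProbabilityMeasure Q]
    {E : Set ((Fin n → Ω) × (Fin n → Ω))}
    (hE : NullMeasurableSet E
      ((Measure.pi fun _ : Fin n => Q).prod (Measure.pi fun _ : Fin n => Q)))
    {η : ℝ} (hcard : ∀ p, ((Finset.univ.filter fun σ : Fin n → Bool => swapAt σ p ∈ E).card : ℝ)
      ≤ 2 ^ n * η) :
    ((Measure.pi fun _ : Fin n => Q).prod (Measure.pi fun _ : Fin n => Q)) E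
      ≤ ENNReal.ofReal η := by
  set ρ := (Measure.pi fun _ : Fin n => Q).prod (Measure.pi fun _ : Fin n => Q)
  have hmp := fun σ => measurePreserving_swapAt (n := n) Q σ
  have hnull : ∀ σ : Fin n → Bool, NullMeasurableSet (swapAt σ ⁻¹' E) ρ := fun σ =>
    hE.preimage (hmp σ).quasiMeasurePreserving
  have hsum : (2 : ENNReal) ^ n * ρ E ≤ 2 ^ n * ENNReal.ofReal η := by
    calc (2 : ENNReal) ^ n * ρ E = ∑ σ : Fin n → Bool, ρ (swapAt σ ⁻¹' E) := by
          rw [Finset.sum_congr rfl fun σ _ => (hmp σ).measure_preimage hE]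
          simp [ρ]
      _ = ∑ σ : Fin n → Bool, ∫⁻ p, (swapAt σ ⁻¹' E).indicator (fun _ => (1 : ENNReal)) p ∂ρ :=
          Finset.sum_congr rfl fun σ _ => (lintegral_indicator_one₀ (hnull σ)).symm
      _ = ∫⁻ p, ∑ σ : Fin n → Bool, (swapAt σ ⁻¹' E).indicator (fun _ => (1 : ENNReal)) p ∂ρ :=
          (lintegral_finsetSum' _ fun σ _ => (aemeasurable_const (b := (1 : ENNReal))).indicator₀
            (hnull σ)).symm
      _ ≤ ∫⁻ _, 2 ^ n * ENNReal.ofReal η ∂ρ := by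
          refine lintegral_mono fun p => ?_
          have h1 : ∑ σ : Fin n → Bool, (swapAt σ ⁻¹' E).indicator (fun _ => (1 : ENNReal)) p
              = ((Finset.univ.filter fun σ : Fin n → Bool => swapAt σ p ∈ E).card : ENNReal) := by
            simp [Set.indicator_apply]
          have h2 : (2 : ENNReal) ^ n * ENNReal.ofReal η = ENNReal.ofReal (2 ^ n * η) := by
            rw [ENNReal.ofReal_mul (by positivity), ENNReal.ofReal_pow (by norm_num)]
            simp
          rw [h1, h2, ← ENNReal.ofReal_natCast]
          exact ENNReal.ofReal_le_ofReal (hcard p)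
      _ = _ := by simp
  exact (ENNReal.mul_le_mul_iff_right (by simp) (by simp)).1 hsum

/-- If every sample in `B` is in relation `E` with at least half of the ghost samples, then
the probability of `B` is at most twice that of `E`. -/
lemma measure_le_two_mul_of_ghost {α β : Type*} [MeasurableSpace α] [MeasurableSpace β]
    (μ : Measure α) (ν : Measure β) [SFinite ν] {B : Set α} {E : Set (α × β)}
    (h : ∀ s ∈ B, 1 / 2 ≤ ν {s' | (s, s') ∈ E}) : μ B ≤ 2 * (μ.prod ν) E := by
  set E' := toMeasurable (μ.prod ν) E
  have hE' : MeasurableSet E' := measurableSet_toMeasurable _ _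
  -- Passing to a measurable hull of `E` allows Tonelli and Markov's inequality although neither `B`
  -- nor `E` is assumed measurable.
  have hB : B ⊆ {s | 1 / 2 ≤ ν (Prod.mk s ⁻¹' E')} := fun s hs =>
    (h s hs).trans (measure_mono fun s' hs' => subset_toMeasurable _ _ hs')
  have h1 := mul_meas_ge_le_lintegral (μ := μ) (measurable_measure_prodMk_left (ν := ν) hE') (1 / 2)
  rw [← Measure.prod_apply hE', measure_toMeasurable] at h1
  calc μ B ≤ μ {s | 1 / 2 ≤ ν (Prod.mk s ⁻¹' E')} := measure_mono hB
    _ = 2 * (1 / 2 * μ {s | 1 / 2 ≤ ν (Prod.mk s ⁻¹' E')}) := by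
        rw [← mul_assoc, one_div, ENNReal.mul_inv_cancel (by simp) (by simp), one_mul]
    _ ≤ _ := by gcongr

end Symmetrization

/-! ### Tail bounds for sums over an i.i.d. sample -/

section Tails

variable {Ω : Type*} [MeasurableSpace Ω] {n : ℕ}

lemma measure_abs_sum_ge_le (Q : Measure Ω) [IsProbabilityMeasure Q] {g : Ω → ℝ}
    (hg : Measurable g) {C v t : ℝ} (hC : ∀ ω, |g ω| ≤ C) (h0 : ∫ ω, g ω ∂Q = 0)
    (hv : ∫ ω, g ω ^ 2 ∂Q ≤ v) (ht : 0 < t) :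
    (Measure.pi fun _ : Fin n => Q) {s | t ≤ |∑ i, g (s i)|} ≤ ENNReal.ofReal (n * v / t ^ 2) := by
  have hL : MemLp g 2 Q := MemLp.of_bound hg.aestronglyMeasurable C (ae_of_all _ hC)
  have hvar : Var[g; Q] ≤ v := by
    rw [variance_of_integral_eq_zero hg.aemeasurable h0]
    exact hv
  have hsumvar := variance_sum_pi (μ := fun _ : Fin n => Q) (X := fun _ => g) fun _ => hL
  have hLi : ∀ i : Fin n, MemLp (fun s : Fin n → Ω => g (s i)) 2 (Measure.pi fun _ => Q) :=
    fun i => hL.comp_measurePreserving (measurePreserving_eval (fun _ : Fin n => Q) i)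
  have hLs : MemLp (∑ i, fun s : Fin n → Ω => g (s i)) 2 (Measure.pi fun _ => Q) :=
    memLp_finsetSum' _ fun i _ => hLi i
  have hmean : ∫ s, (∑ i, fun s : Fin n → Ω => g (s i)) s ∂(Measure.pi fun _ => Q) = 0 := by
    simp only [Finset.sum_apply]
    rw [integral_finsetSum _ fun i _ => (hLi i).integrable (by norm_num)]
    refine Finset.sum_eq_zero fun i _ => ?_
    have h := (measurePreserving_eval (fun _ : Fin n => Q) i).map_eq
    have h' := integral_map (μ := Measure.pi fun _ : Fin n => Q) (φ := Function.eval i)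
      (measurable_pi_apply i).aemeasurable (f := g) hg.aestronglyMeasurable
    rw [h, h0] at h'
    exact h'.symm
  have := meas_ge_le_variance_div_sq hLs ht
  rw [hmean, hsumvar] at this
  simp only [Finset.sum_apply, sub_zero, Finset.sum_const, Finset.card_univ, Fintype.card_fin,
    nsmul_eq_mul] at this
  refine this.trans (ENNReal.ofReal_le_ofReal ?_)
  gcongr

/-- The number of sample points in `W`. -/
noncomputable def hits (W : Set Ω) (s : Fin n → Ω) : ℝ := ∑ i, W.indicator 1 (s i)

omit [MeasurableSpace Ω] in
lemma hits_nonneg (W : Set Ω) (s : Fin n → Ω) : 0 ≤ hits W s :=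
  Finset.sum_nonneg fun _ _ => Set.indicator_nonneg (fun _ _ => zero_le_one) _

omit [MeasurableSpace Ω] in
lemma hits_le (W : Set Ω) (s : Fin n → Ω) : hits W s ≤ n := by
  calc hits W s ≤ ∑ _i : Fin n, (1 : ℝ) :=
        Finset.sum_le_sum fun i _ => Set.indicator_le_self' (f := 1) (fun _ _ => zero_le_one) _
    _ = n := by simp

lemma measurable_hits {W : Set Ω} (hW : MeasurableSet W) :
    Measurable (hits W : (Fin n → Ω) → ℝ) :=
  Finset.measurable_sum _ fun i _ =>
    (measurable_one.indicator hW).comp (measurable_pi_apply i)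

lemma integrable_exp_hits (Q : Measure Ω) [IsProbabilityMeasure Q] {W : Set Ω}
    (hW : MeasurableSet W) (t : ℝ) :
    Integrable (fun s : Fin n → Ω => Real.exp (t * hits W s)) (Measure.pi fun _ => Q) := by
  refine Integrable.of_bound (C := Real.exp (|t| * n))
    (((measurable_hits hW).const_mul t).exp).aestronglyMeasurable (ae_of_all _ fun s => ?_)
  rw [Real.norm_eq_abs, Real.abs_exp]
  refine Real.exp_le_exp.2 ((le_abs_self _).trans ?_)
  rw [abs_mul, abs_of_nonneg (hits_nonneg W s)]
  exact mul_le_mul_of_nonneg_left (hits_le W s) (abs_nonneg t)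

/-- The count is binomial, so its moment generating function is `(1 + (exp t - 1) p) ^ n`, and `1 +
z ≤ exp z`. -/
lemma mgf_hits_le (Q : Measure Ω) [IsProbabilityMeasure Q] {W : Set Ω}
    (hW : MeasurableSet W) (t : ℝ) :
    mgf (hits W : (Fin n → Ω) → ℝ) (Measure.pi fun _ => Q) t
      ≤ Real.exp (n * Q.real W * (Real.exp t - 1)) := by
  have h1 : ∀ ω, Real.exp (t * W.indicator 1 ω) = 1 + (Real.exp t - 1) * W.indicator 1 ω := by
    intro ω
    by_cases h : ω ∈ W <;> simp [h]
  have h2 : ∫ ω, Real.exp (t * W.indicator 1 ω) ∂Q = 1 + (Real.exp t - 1) * Q.real W := by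
    have hi : Integrable (W.indicator (1 : Ω → ℝ)) Q :=
      (integrable_const (1 : ℝ)).indicator hW
    simp_rw [h1]
    rw [integral_add (integrable_const _) (hi.const_mul _), integral_const_mul,
      integral_indicator_one hW]
    simp
  have h3 : mgf (hits W : (Fin n → Ω) → ℝ) (Measure.pi fun _ => Q) t
      = (1 + (Real.exp t - 1) * Q.real W) ^ n := by
    simp only [mgf, hits, Finset.mul_sum, Real.exp_sum]
    rw [integral_fintype_prod_eq_pow (fun ω => Real.exp (t * W.indicator 1 ω)), h2,
      Fintype.card_fin]
  have h0 : 0 ≤ 1 + (Real.exp t - 1) * Q.real W := by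
    rw [← h2]
    exact integral_nonneg fun ω => (Real.exp_pos _).le
  rw [h3]
  calc (1 + (Real.exp t - 1) * Q.real W) ^ n
      ≤ Real.exp ((Real.exp t - 1) * Q.real W) ^ n := by
        gcongr
        rw [add_comm]
        exact Real.add_one_le_exp _
    _ = _ := by rw [← Real.exp_nat_mul]; ring_nf

/-- Both Chernoff bounds use the fixed parameters `±1/2` instead of optimal ones; these estimates
yield the rates `1/12` and `1/8`. -/
lemma exp_half_bounds : 8 / 5 ≤ Real.exp (1 / 2) ∧ Real.exp (1 / 2) ≤ 5 / 3 := by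
  have h : Real.exp (1 / 2) ^ 2 = Real.exp 1 := by
    rw [← Real.exp_nat_mul]
    norm_num
  have h1 := Real.exp_one_gt_d9
  have h2 := Real.exp_one_lt_d9
  have h3 := Real.exp_pos (1 / 2)
  constructor <;> nlinarith

/-- Chernoff's upper tail bound. -/
lemma measure_hits_ge_le (Q : Measure Ω) [IsProbabilityMeasure Q] {W : Set Ω}
    (hW : MeasurableSet W) :
    (Measure.pi fun _ : Fin n => Q) {s | 3 / 2 * (n * Q.real W) ≤ hits W s}
      ≤ ENNReal.ofReal (Real.exp (-(n * Q.real W / 12))) := by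
  have h := measure_ge_le_exp_mul_mgf (3 / 2 * (n * Q.real W)) (by norm_num : (0 : ℝ) ≤ 1 / 2)
    (integrable_exp_hits (n := n) Q hW (1 / 2))
  rw [← ofReal_measureReal]
  refine ENNReal.ofReal_le_ofReal (h.trans ?_)
  refine (mul_le_mul_of_nonneg_left (mgf_hits_le Q hW _) (Real.exp_pos _).le).trans ?_
  rw [← Real.exp_add]
  refine Real.exp_le_exp.2 ?_
  have hp : 0 ≤ n * Q.real W := by positivity
  nlinarith [exp_half_bounds.2]

/-- Chernoff's lower tail bound. -/
lemma measure_hits_le_le (Q : Measure Ω) [IsProbabilityMeasure Q] {W : Set Ω}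
    (hW : MeasurableSet W) :
    (Measure.pi fun _ : Fin n => Q) {s | hits W s ≤ n * Q.real W / 2}
      ≤ ENNReal.ofReal (Real.exp (-(n * Q.real W / 8))) := by
  have h := measure_le_le_exp_mul_mgf (n * Q.real W / 2) (by norm_num : -(1 / 2 : ℝ) ≤ 0)
    (integrable_exp_hits (n := n) Q hW (-(1 / 2)))
  rw [← ofReal_measureReal]
  refine ENNReal.ofReal_le_ofReal (h.trans ?_)
  refine (mul_le_mul_of_nonneg_left (mgf_hits_le Q hW _) (Real.exp_pos _).le).trans ?_
  rw [← Real.exp_add]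
  refine Real.exp_le_exp.2 ?_
  have hp : 0 ≤ n * Q.real W := by positivity
  have he : Real.exp (-(1 / 2)) ≤ 5 / 8 := by
    rw [Real.exp_neg, inv_le_comm₀ (Real.exp_pos _) (by norm_num)]
    linarith [exp_half_bounds.1]
  nlinarith

end Tails

/-! ### A relative deviation bound for classes of finite VC dimension -/

section RelativeDeviation

variable {X Ω : Type*} {n : ℕ}

/-- The points of `W` at which the prediction of `h` differs from the target `y`. -/
def miss (W : Set Ω) (x : Ω → X) (y : Ω → Bool) (h : X → Bool) : Set Ω :=
  W ∩ {ω | h (x ω) ≠ y ω}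

lemma miss_subset (W : Set Ω) (x : Ω → X) (y : Ω → Bool) (h : X → Bool) : miss W x y h ⊆ W :=
  Set.inter_subset_left

lemma measurableSet_miss [MeasurableSpace X] [MeasurableSpace Ω] {W : Set Ω} {x : Ω → X}
    {y : Ω → Bool} {h : X → Bool} (hW : MeasurableSet W) (hx : Measurable x) (hy : Measurable y)
    (hh : Measurable h) : MeasurableSet (miss W x y h) :=
  hW.inter (measurableSet_eq_fun (hh.comp hx) hy).compl

/-- The number of pairs of a sample and a ghost sample with at least one member in `W`. -/
noncomputable def spread (W : Set Ω) (p : (Fin n → Ω) × (Fin n → Ω)) : ℝ :=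
  ∑ i, max (W.indicator 1 (p.1 i)) (W.indicator 1 (p.2 i))

lemma spread_le_card (W : Set Ω) (p : (Fin n → Ω) × (Fin n → Ω)) : spread W p ≤ n := by
  calc spread W p ≤ ∑ _i : Fin n, (1 : ℝ) :=
        Finset.sum_le_sum fun i _ => max_le
          (Set.indicator_le_self' (f := 1) (fun _ _ => zero_le_one) _)
          (Set.indicator_le_self' (f := 1) (fun _ _ => zero_le_one) _)
    _ = n := by simp

lemma spread_le_hits_add_hits (W : Set Ω) (p : (Fin n → Ω) × (Fin n → Ω)) :
    spread W p ≤ hits W p.1 + hits W p.2 := by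
  rw [hits, hits, ← Finset.sum_add_distrib]
  refine Finset.sum_le_sum fun i _ => max_le_add_of_nonneg ?_ ?_ <;>
    exact Set.indicator_nonneg (fun _ _ => zero_le_one) _

lemma spread_swapAt (W : Set Ω) (p : (Fin n → Ω) × (Fin n → Ω)) (σ : Fin n → Bool) :
    spread W (swapAt σ p) = spread W p := by
  refine Finset.sum_congr rfl fun i _ => ?_
  rcases h : σ i with _ | _ <;> simp [swapAt, h, max_comm]

lemma hits_swapAt_sub (V : Set Ω) (p : (Fin n → Ω) × (Fin n → Ω)) (σ : Fin n → Bool) :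
    hits V (swapAt σ p).1 - hits V (swapAt σ p).2
      = ∑ i, sgn (σ i) * (V.indicator 1 (p.1 i) - V.indicator 1 (p.2 i)) := by
  rw [hits, hits, ← Finset.sum_sub_distrib]
  refine Finset.sum_congr rfl fun i _ => ?_
  rcases h : σ i with _ | _ <;> simp [swapAt, h, sgn]

-- The summands differ from zero only at pairs meeting `V ⊆ W`, so their squares sum to at most
-- `spread W p`. As `spread` is invariant under exchanges, the threshold is the same for all sign
-- patterns and Hoeffding's inequality applies.
open Classical in
lemma card_swapAt_deviation_le {V W : Set Ω} (hVW : V ⊆ W) (p : (Fin n → Ω) × (Fin n → Ω))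
    {K : ℝ} (hK : 0 ≤ K) :
    ((Finset.univ.filter fun σ : Fin n → Bool => spread W (swapAt σ p) * K
        < (hits V (swapAt σ p).1 - hits V (swapAt σ p).2) ^ 2).card : ℝ)
      ≤ 2 ^ n * (2 * Real.exp (-K / 2)) := by
  simp only [spread_swapAt, hits_swapAt_sub]
  convert card_signs_le (fun i => V.indicator (1 : Ω → ℝ) (p.1 i) - V.indicator 1 (p.2 i))
    (N := spread W p) hK ?_
  refine Finset.sum_le_sum fun i _ => ?_
  by_cases h1 : p.1 i ∈ V <;> by_cases h2 : p.2 i ∈ V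
  · simp only [h1, h2, Set.indicator_of_mem, Pi.one_apply, sub_self, ne_eq, OfNat.ofNat_ne_zero,
      not_false_eq_true, zero_pow]
    exact le_max_of_le_left (Set.indicator_nonneg (fun _ _ => zero_le_one) _)
  · simp [h1, h2, hVW h1]
  · simp [h1, h2, hVW h2]
  · simp only [h1, h2, not_false_eq_true, Set.indicator_of_notMem, sub_self, ne_eq,
      OfNat.ofNat_ne_zero, zero_pow]
    exact le_max_of_le_left (Set.indicator_nonneg (fun _ _ => zero_le_one) _)

/-- The double samples on which the number of points in `W`, or the number of misses of some
hypothesis in `W`, differs a lot between the two samples. -/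
def deviation (H : Set (X → Bool)) (W : Set Ω) (x : Ω → X) (y : Ω → Bool) (n : ℕ) (K : ℝ) :
    Set ((Fin n → Ω) × (Fin n → Ω)) :=
  {p | (∃ h ∈ H, spread W p * K < (hits (miss W x y h) p.1 - hits (miss W x y h) p.2) ^ 2) ∨
    spread W p * K < (hits W p.1 - hits W p.2) ^ 2}

lemma hits_miss_congr {W : Set Ω} {x : Ω → X} {y : Ω → Bool} {h h' : X → Bool} {s : Fin n → Ω}
    (hs : ∀ i, h (x (s i)) = h' (x (s i))) : hits (miss W x y h) s = hits (miss W x y h') s := by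
  classical
  refine Finset.sum_congr rfl fun i _ => ?_
  simp [miss, Set.indicator_apply, hs i]

-- Exchanges only redistribute the same `2n` points, so the deviation for `h` depends on `h` only
-- through its pattern there. A union bound runs over one representative per pattern, plus one extra
-- term for the count of `W` itself.
open Classical in
lemma card_swapAt_mem_deviation_le {H : Set (X → Bool)} (hH : H.Nonempty) {d : ℕ}
    (hd : vcDim H = d) (hdn : d ≤ 2 * n) (W : Set Ω) (x : Ω → X) (y : Ω → Bool)
    {K : ℝ} (hK : 0 ≤ K) (p : (Fin n → Ω) × (Fin n → Ω)) :
    ((Finset.univ.filter fun σ : Fin n → Bool => swapAt σ p ∈ deviation H W x y n K).card : ℝ)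
      ≤ 2 ^ n * (4 * (2 * Real.exp 1 * n / d) ^ d * Real.exp (-K / 2)) := by
  set u : Fin n ⊕ Fin n → X := Sum.elim (fun i => x (p.1 i)) fun i => x (p.2 i)
  set T := {β : Fin n ⊕ Fin n → Bool | ∃ h ∈ H, ∀ i, h (u i) = β i}
  have hTfin : T.Finite := Set.toFinite T
  have hTcard : (hTfin.toFinset.card : ℝ) ≤ (2 * Real.exp 1 * n / d) ^ d := by
    have h1 := ncard_patterns_le hd u
    have h2 := sum_choose_le (d := d) (m := 2 * n) hdn
    rw [Fintype.card_sum, Fintype.card_fin, ← two_mul] at h1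
    rw [Set.ncard_eq_toFinset_card _ hTfin] at h1
    calc (hTfin.toFinset.card : ℝ) ≤ _ := Nat.cast_le.2 h1
      _ ≤ _ := h2
      _ = _ := by push_cast; ring_nf
  -- At least one pattern exists, so the extra term for `W` is absorbed by doubling the number of
  -- patterns.
  have hone : 1 ≤ hTfin.toFinset.card := by
    obtain ⟨h, hh⟩ := hH
    exact Finset.card_pos.2 ⟨fun i => h (u i), hTfin.mem_toFinset.2 ⟨h, hh, fun i => rfl⟩⟩
  choose! g hgH hg using fun β (hβ : β ∈ T) => hβ
  let F : Set Ω → Finset (Fin n → Bool) := fun V =>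
    Finset.univ.filter fun σ : Fin n → Bool => spread W (swapAt σ p) * K
        < (hits V (swapAt σ p).1 - hits V (swapAt σ p).2) ^ 2
  have hF : ∀ V ⊆ W, ((F V).card : ℝ) ≤ 2 ^ n * (2 * Real.exp (-K / 2)) := fun V hV =>
    card_swapAt_deviation_le hV p hK
  have hsub : (Finset.univ.filter fun σ : Fin n → Bool => swapAt σ p ∈ deviation H W x y n K)
      ⊆ (hTfin.toFinset.biUnion fun β => F (miss W x y (g β))) ∪ F W := by
    intro σ hσ
    rw [Finset.mem_filter] at hσ
    rw [Finset.mem_union, Finset.mem_biUnion]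
    rcases hσ.2 with ⟨h, hh, hdev⟩ | hdev
    · left
      have hβ : (fun i => h (u i)) ∈ T := ⟨h, hh, fun i => rfl⟩
      refine ⟨_, hTfin.mem_toFinset.2 hβ, Finset.mem_filter.2 ⟨Finset.mem_univ _, ?_⟩⟩
      have hgu := hg _ hβ
      have e1 : ∀ i, g (fun i => h (u i)) (x (p.1 i)) = h (x (p.1 i)) := fun i => hgu (Sum.inl i)
      have e2 : ∀ i, g (fun i => h (u i)) (x (p.2 i)) = h (x (p.2 i)) := fun i => hgu (Sum.inr i)
      rwa [hits_miss_congr (h := g fun i => h (u i)) (h' := h),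
        hits_miss_congr (h := g fun i => h (u i)) (h' := h)]
      · intro i
        rcases hi : σ i with _ | _ <;> simp [swapAt, hi, e1, e2]
      · intro i
        rcases hi : σ i with _ | _ <;> simp [swapAt, hi, e1, e2]
    · exact Or.inr (Finset.mem_filter.2 ⟨Finset.mem_univ _, hdev⟩)
  have hcard : ((Finset.univ.filter fun σ : Fin n → Bool =>
      swapAt σ p ∈ deviation H W x y n K).card : ℝ)
      ≤ ∑ β ∈ hTfin.toFinset, ((F (miss W x y (g β))).card : ℝ) + (F W).card := by
    refine (Nat.cast_le.2 ((Finset.card_le_card hsub).trans ((Finset.card_union_le _ _).trans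
      (Nat.add_le_add_right Finset.card_biUnion_le _)))).trans ?_
    push_cast
    rfl
  have hsum : ∑ β ∈ hTfin.toFinset, ((F (miss W x y (g β))).card : ℝ)
      ≤ hTfin.toFinset.card * (2 ^ n * (2 * Real.exp (-K / 2))) := by
    rw [← nsmul_eq_mul]
    exact Finset.sum_le_card_nsmul _ _ _ fun β _ => hF _ (miss_subset _ _ _ _)
  have hW := hF W subset_rfl
  have hone' : (1 : ℝ) ≤ hTfin.toFinset.card := by exact_mod_cast hone
  have hpos : 0 ≤ 2 ^ n * (2 * Real.exp (-K / 2)) := by positivity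
  calc _ ≤ (hTfin.toFinset.card + 1) * (2 ^ n * (2 * Real.exp (-K / 2))) := by linarith
    _ ≤ (2 * (2 * Real.exp 1 * n / d) ^ d) * (2 ^ n * (2 * Real.exp (-K / 2))) := by
        gcongr
        linarith
    _ = _ := by ring

variable [MeasurableSpace X] [MeasurableSpace Ω]

lemma measurable_spread {W : Set Ω} (hW : MeasurableSet W) :
    Measurable (spread W : (Fin n → Ω) × (Fin n → Ω) → ℝ) :=
  Finset.measurable_sum _ fun i _ =>
    ((measurable_one.indicator hW).comp ((measurable_pi_apply i).comp measurable_fst)).max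
      ((measurable_one.indicator hW).comp ((measurable_pi_apply i).comp measurable_snd))

lemma RegularClass.nullMeasurableSet_trace {H : Set (X → Bool)} {ν : Measure X}
    [IsProbabilityMeasure ν] (hreg : RegularClass H ν) {ι : Type*} [Fintype ι] (β : ι → Bool) :
    NullMeasurableSet {x : ι → X | ∃ h ∈ H, ∀ i, h (x i) = β i} (Measure.pi fun _ => ν) := by
  set e := Fintype.equivFin ι
  have h := (hreg.trace _ (β ∘ e.symm)).preimage
    (measurePreserving_piCongrLeft (fun _ => ν) e).quasiMeasurePreserving
  convert h using 1
  ext x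
  simp only [Set.mem_ofPred_eq, Set.mem_preimage, MeasurableEquiv.coe_piCongrLeft]
  refine exists_congr fun f => and_congr_right fun _ => ?_
  rw [← e.forall_congr_right (q := fun j => f ((Equiv.piCongrLeft (fun _ => X) e) x j) = _)]
  simp [Equiv.piCongrLeft_apply_apply]

/-- The possibly uncountable union over `H` is rewritten as a finite union over patterns: a pattern
being realized is null measurable by regularity of the class, and with the pattern fixed the
counting condition is measurable. -/
lemma nullMeasurableSet_deviation (Q : Measure Ω) [IsProbabilityMeasure Q] {H : Set (X → Bool)}
    {W : Set Ω} {x : Ω → X} {y : Ω → Bool} (hW : MeasurableSet W) (hx : Measurable x)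
    (hy : Measurable y) (hreg : RegularClass H (Q.map x)) (K : ℝ) :
    NullMeasurableSet (deviation H W x y n K)
      ((Measure.pi fun _ : Fin n => Q).prod (Measure.pi fun _ : Fin n => Q)) := by
  classical
  have : IsProbabilityMeasure (Q.map x) := Measure.isProbabilityMeasure_map hx.aemeasurable
  have hmp1 : MeasurePreserving (fun (s : Fin n → Ω) i => x (s i)) (Measure.pi fun _ => Q)
      (Measure.pi fun _ => Q.map x) :=
    measurePreserving_pi (fun _ => Q) (fun _ => Q.map x) fun _ => ⟨hx, rfl⟩
  have hmp : MeasurePreserving (fun (p : (Fin n → Ω) × (Fin n → Ω)) =>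
      (MeasurableEquiv.sumPiEquivProdPi fun _ : Fin n ⊕ Fin n => X).symm
        (Prod.map (fun s i => x (s i)) (fun s i => x (s i)) p))
      ((Measure.pi fun _ : Fin n => Q).prod (Measure.pi fun _ : Fin n => Q))
      (Measure.pi fun _ => Q.map x) :=
    (measurePreserving_sumPiEquivProdPi_symm fun _ : Fin n ⊕ Fin n => Q.map x).comp
      (hmp1.prod hmp1)
  have hlast : MeasurableSet {p : (Fin n → Ω) × (Fin n → Ω) |
      spread W p * K < (hits W p.1 - hits W p.2) ^ 2} :=
    measurableSet_lt ((measurable_spread hW).mul_const K)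
      ((((measurable_hits hW).comp measurable_fst).sub
        ((measurable_hits hW).comp measurable_snd)).pow_const 2)
  let cnt : (Fin n → Bool) → (Fin n → Ω) → ℝ := fun b s =>
    ∑ i, (W ∩ {ω | b i ≠ y ω}).indicator 1 (s i)
  have hcnt : ∀ b, Measurable (cnt b) := fun b =>
    Finset.measurable_sum _ fun i _ => (measurable_one.indicator
      (hW.inter (measurableSet_eq_fun measurable_const hy).compl)).comp (measurable_pi_apply i)
  have hcnt_eq : ∀ (h : X → Bool) (b : Fin n → Bool) (s : Fin n → Ω),
      (∀ i, h (x (s i)) = b i) → hits (miss W x y h) s = cnt b s := by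
    intro h b s hs
    refine Finset.sum_congr rfl fun i _ => ?_
    simp [miss, Set.indicator_apply, hs i]
  have heq : deviation H W x y n K =
      (⋃ β : Fin n ⊕ Fin n → Bool,
        ((fun p : (Fin n → Ω) × (Fin n → Ω) =>
          (MeasurableEquiv.sumPiEquivProdPi fun _ : Fin n ⊕ Fin n => X).symm
            (Prod.map (fun s i => x (s i)) (fun s i => x (s i)) p)) ⁻¹'
            {z | ∃ h ∈ H, ∀ i, h (z i) = β i})
        ∩ {p | spread W p * K < (cnt (fun i => β (Sum.inl i)) p.1
            - cnt (fun i => β (Sum.inr i)) p.2) ^ 2})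
      ∪ {p | spread W p * K < (hits W p.1 - hits W p.2) ^ 2} := by
    ext p
    refine or_congr ?_ Iff.rfl
    simp only [Set.mem_iUnion, Set.mem_inter_iff, Set.mem_preimage, Set.mem_ofPred_eq]
    constructor
    · rintro ⟨h, hh, hdev⟩
      refine ⟨Sum.elim (fun i => h (x (p.1 i))) fun i => h (x (p.2 i)), ⟨h, hh, ?_⟩, ?_⟩
      · rintro (i | i) <;> rfl
      · rw [hcnt_eq h _ p.1 fun i => rfl, hcnt_eq h _ p.2 fun i => rfl] at hdev
        exact hdev
    · rintro ⟨β, ⟨h, hh, hβ⟩, hdev⟩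
      refine ⟨h, hh, ?_⟩
      rwa [hcnt_eq h _ _ fun i => hβ (Sum.inl i), hcnt_eq h _ _ fun i => hβ (Sum.inr i)]
  rw [heq]
  refine NullMeasurableSet.union (NullMeasurableSet.iUnion fun β => NullMeasurableSet.inter
    ((hreg.nullMeasurableSet_trace β).preimage hmp.quasiMeasurePreserving)
    (MeasurableSet.nullMeasurableSet ?_)) hlast.nullMeasurableSet
  exact measurableSet_lt ((measurable_spread hW).mul_const K)
    ((((hcnt _).comp measurable_fst).sub ((hcnt _).comp measurable_snd)).pow_const 2)

/-- The symmetrization bound for a class of finite VC dimension. -/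
theorem measure_le_of_ghost_deviation (Q : Measure Ω) [IsProbabilityMeasure Q]
    {H : Set (X → Bool)} (hH : H.Nonempty) {d : ℕ} (hd : vcDim H = d) (hdn : d ≤ 2 * n)
    {W : Set Ω} {x : Ω → X} {y : Ω → Bool} (hW : MeasurableSet W) (hx : Measurable x)
    (hy : Measurable y) (hreg : RegularClass H (Q.map x)) {K : ℝ} (hK : 0 ≤ K)
    {B : Set (Fin n → Ω)} (hB : ∀ s ∈ B,
      1 / 2 ≤ (Measure.pi fun _ : Fin n => Q) {s' | (s, s') ∈ deviation H W x y n K}) :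
    (Measure.pi fun _ : Fin n => Q) B
      ≤ ENNReal.ofReal (8 * (2 * Real.exp 1 * n / d) ^ d * Real.exp (-K / 2)) := by
  classical
  have h1 := prod_measure_le_of_card_swapAt_le Q
    (nullMeasurableSet_deviation (n := n) Q hW hx hy hreg K)
    (fun p => by convert card_swapAt_mem_deviation_le hH hd hdn W x y hK p)
  refine (measure_le_two_mul_of_ghost _ _ hB).trans ((mul_le_mul_right h1 2).trans ?_)
  rw [show (2 : ENNReal) = ENNReal.ofReal 2 by simp, ← ENNReal.ofReal_mul (by norm_num)]
  refine ENNReal.ofReal_le_ofReal (le_of_eq ?_)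
  ring

end RelativeDeviation

/-! ### Uniform deviations of risks and of conditional frequencies -/

section UniformDeviation

variable {X Ω : Type*} [MeasurableSpace X] [MeasurableSpace Ω] {n : ℕ}

/-- Chebyshev's inequality for the number of points in `V`, relative to that in `W`. -/
lemma measure_abs_hits_sub_ge_le (Q : Measure Ω) [IsProbabilityMeasure Q] {V W : Set Ω}
    (hV : MeasurableSet V) (hW : MeasurableSet W) (hVW : V ⊆ W) {q t : ℝ} (hq : 0 ≤ q)
    (hq' : q ≤ 1) (hVq : Q.real V = q * Q.real W) (ht : 0 < t) :
    (Measure.pi fun _ : Fin n => Q) {s | t ≤ |hits V s - q * hits W s|}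
      ≤ ENNReal.ofReal (n * Q.real W / t ^ 2) := by
  have hiV : Integrable (V.indicator (1 : Ω → ℝ)) Q := (integrable_const (1 : ℝ)).indicator hV
  have hiW : Integrable (W.indicator (1 : Ω → ℝ)) Q := (integrable_const (1 : ℝ)).indicator hW
  -- Domination by the indicator of `W` makes the second moment at most `Q.real W`; this is what
  -- makes the bound relative to `W`.
  have hbound : ∀ ω, |V.indicator (1 : Ω → ℝ) ω - q * W.indicator 1 ω| ≤ W.indicator 1 ω := by
    intro ω
    by_cases hw : ω ∈ W
    · by_cases hv : ω ∈ V
      · simp only [hv, hw, Set.indicator_of_mem, Pi.one_apply]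
        rw [abs_le]
        constructor <;> linarith
      · simp only [hv, hw, not_false_eq_true, Set.indicator_of_notMem, Set.indicator_of_mem,
          Pi.one_apply]
        rw [abs_le]
        constructor <;> linarith
    · have hv : ω ∉ V := fun h => hw (hVW h)
      simp [hv, hw]
  have hW1 : ∀ ω, W.indicator (1 : Ω → ℝ) ω ≤ 1 :=
    fun ω => Set.indicator_le_self' (f := 1) (fun _ _ => zero_le_one) ω
  have hW0 : ∀ ω, 0 ≤ W.indicator (1 : Ω → ℝ) ω :=
    fun ω => Set.indicator_nonneg (fun _ _ => zero_le_one) ω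
  have hmeas : Measurable fun ω => V.indicator (1 : Ω → ℝ) ω - q * W.indicator 1 ω :=
    (measurable_one.indicator hV).sub ((measurable_one.indicator hW).const_mul q)
  have h := measure_abs_sum_ge_le (n := n) (C := 1) (v := Q.real W) Q hmeas
    (fun ω => (hbound ω).trans (hW1 ω)) ?_ ?_ ht
  · convert h using 5 with s
    rw [Finset.sum_sub_distrib, ← Finset.mul_sum]
    rfl
  · rw [integral_sub hiV (hiW.const_mul q), integral_const_mul, integral_indicator_one hV,
      integral_indicator_one hW, hVq, sub_self]
  · rw [← integral_indicator_one hW]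
    refine integral_mono_of_nonneg (ae_of_all _ fun ω => sq_nonneg _) hiW
      (ae_of_all _ fun ω => ?_)
    have h1 := hbound ω
    have h2 := hW1 ω
    have h3 := hW0 ω
    change (V.indicator (1 : Ω → ℝ) ω - q * W.indicator 1 ω) ^ 2 ≤ W.indicator 1 ω
    rw [← sq_abs]
    nlinarith [abs_nonneg (V.indicator (1 : Ω → ℝ) ω - q * W.indicator 1 ω)]

lemma half_le_measure_of_compl_le {α : Type*} [MeasurableSpace α] {μ : Measure α}
    [IsProbabilityMeasure μ] {G : Set α} (hG : μ Gᶜ ≤ ENNReal.ofReal (1 / 2)) :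
    1 / 2 ≤ μ G := by
  have h : 1 ≤ μ G + μ Gᶜ := by
    rw [← measure_univ (μ := μ), ← Set.union_compl_self G]
    exact measure_union_le _ _
  have hh : ENNReal.ofReal (1 / 2) = 1 / 2 := by
    rw [ENNReal.ofReal_div_of_pos (by norm_num)]
    simp
  rw [hh] at hG
  have h2 : (1 : ENNReal) / 2 + 1 / 2 ≤ μ G + 1 / 2 := by
    rw [ENNReal.add_halves]
    exact h.trans (by gcongr)
  exact (ENNReal.add_le_add_iff_right (by simp)).1 h2

variable {H : Set (X → Bool)} {d : ℕ} {W : Set Ω} {x : Ω → X} {y : Ω → Bool}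

/-- Uniform deviation of the frequencies of misses. -/
lemma measure_exists_miss_deviation_le (Q : Measure Ω) [IsProbabilityMeasure Q]
    (hH : H.Nonempty) (hd : vcDim H = d) (hdn : d ≤ 2 * n) (hx : Measurable x)
    (hy : Measurable y) (hreg : RegularClass H (Q.map x)) {r : ℝ} (hr : 0 < r)
    (hn : 2 ≤ n * r ^ 2) :
    (Measure.pi fun _ : Fin n => Q) {s | ∃ h ∈ H, 2 * r * n
        < |hits (miss Set.univ x y h) s - Q.real (miss Set.univ x y h) * n|}
      ≤ ENNReal.ofReal (8 * (2 * Real.exp 1 * n / d) ^ d * Real.exp (-(n * r ^ 2) / 2)) := by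
  have hn0 : (0 : ℝ) < n := by
    rcases Nat.eq_zero_or_pos n with rfl | h
    · norm_num at hn
    · exact_mod_cast h
  have huniv : ∀ s : Fin n → Ω, hits Set.univ s = n := fun s => by simp [hits]
  refine measure_le_of_ghost_deviation Q hH hd hdn MeasurableSet.univ hx hy hreg
    (by positivity) ?_
  rintro s ⟨h, hh, hs⟩
  have hm := measurableSet_miss MeasurableSet.univ hx hy (hreg.measurable h hh)
  -- With `t = r n` Chebyshev's bound is `1 / (n r²) ≤ 1/2`. A deviation above `2 r n` then leaves a
  -- gap above `r n` from the ghost sample, whose square exceeds `n * K` for `K = n r²`.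
  have hcheb := measure_abs_hits_sub_ge_le (n := n) Q hm MeasurableSet.univ (Set.subset_univ _)
    (q := Q.real (miss Set.univ x y h)) measureReal_nonneg measureReal_le_one (by simp)
    (t := r * n) (by positivity)
  have hG : 1 / 2 ≤ (Measure.pi fun _ : Fin n => Q) {s' | |hits (miss Set.univ x y h) s'
      - Q.real (miss Set.univ x y h) * hits Set.univ s'| < r * n} := by
    refine half_le_measure_of_compl_le ?_
    refine (le_of_eq ?_).trans (hcheb.trans (ENNReal.ofReal_le_ofReal ?_))
    · congr 1
      ext s'
      simp
    · rw [probReal_univ, div_le_div_iff₀ (by positivity) (by norm_num)]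
      nlinarith
  refine hG.trans (measure_mono fun s' hs' => Or.inl ⟨h, hh, ?_⟩)
  have hs'' : |hits (miss Set.univ x y h) s' - Q.real (miss Set.univ x y h) * n| < r * n := by
    rw [← huniv s']
    convert hs' using 1
    simp [huniv]
  have hlt : r * n < |hits (miss Set.univ x y h) s - hits (miss Set.univ x y h) s'| := by
    have := abs_sub_abs_le_abs_sub
      (hits (miss Set.univ x y h) s - Q.real (miss Set.univ x y h) * n)
      (hits (miss Set.univ x y h) s' - Q.real (miss Set.univ x y h) * n)
    rw [sub_sub_sub_cancel_right] at this
    linarith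
  calc spread Set.univ (s, s') * (n * r ^ 2) ≤ n * (n * r ^ 2) := by
        gcongr
        exact spread_le_card _ _
    _ = (r * n) ^ 2 := by ring
    _ < |hits (miss Set.univ x y h) s - hits (miss Set.univ x y h) s'| ^ 2 := by gcongr
    _ = _ := sq_abs _

/-- Uniform deviation of the conditional frequencies of misses, given `W`. -/
lemma measure_exists_miss_relative_deviation_le (Q : Measure Ω) [IsProbabilityMeasure Q]
    (hH : H.Nonempty) (hd : vcDim H = d) (hdn : d ≤ 2 * n) (hW : MeasurableSet W)
    (hx : Measurable x) (hy : Measurable y) (hreg : RegularClass H (Q.map x))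
    {q : (X → Bool) → ℝ} (hq : ∀ h ∈ H, 0 ≤ q h) (hq' : ∀ h ∈ H, q h ≤ 1)
    (hqW : ∀ h ∈ H, Q.real (miss W x y h) = q h * Q.real W) {f K : ℝ} (hf : 0 < f)
    (hK : 9 ≤ K) (hKf : K ≤ n * Q.real W * f ^ 2) (hnW : 18 ≤ n * Q.real W) :
    (Measure.pi fun _ : Fin n => Q) {s | n * Q.real W / 2 ≤ hits W s ∧ ∃ h ∈ H,
        8 * f * hits W s < |hits (miss W x y h) s - q h * hits W s|}
      ≤ ENNReal.ofReal (8 * (2 * Real.exp 1 * n / d) ^ d * Real.exp (-K / 2)) := by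
  set p := Q.real W with hp
  have hnp : 0 < n * p := by linarith
  refine measure_le_of_ghost_deviation Q hH hd hdn hW hx hy hreg (by linarith) ?_
  rintro s ⟨hU, h, hh, hs⟩
  have hm := measurableSet_miss hW hx hy (hreg.measurable h hh)
  -- The failure probabilities are each at most `1/4`: here by `n p f² ≥ K ≥ 9`, and for the
  -- Chernoff bound by `n p ≥ 18`.
  have hcheb := measure_abs_hits_sub_ge_le (n := n) Q hm hW (miss_subset W x y h)
    (hq h hh) (hq' h hh) (hqW h hh) (t := 2 / 3 * (n * p) * f) (by positivity)
  have hchern := measure_hits_ge_le (n := n) Q hW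
  rw [← hp] at hcheb hchern
  have hG : 1 / 2 ≤ (Measure.pi fun _ : Fin n => Q) {s' | |hits (miss W x y h) s'
      - q h * hits W s'| < 2 / 3 * (n * p) * f ∧ hits W s' < 3 / 2 * (n * p)} := by
    refine half_le_measure_of_compl_le ?_
    have hsub : {s' : Fin n → Ω | |hits (miss W x y h) s' - q h * hits W s'| < 2 / 3 * (n * p) * f
        ∧ hits W s' < 3 / 2 * (n * p)}ᶜ
        ⊆ {s' | 2 / 3 * (n * p) * f ≤ |hits (miss W x y h) s' - q h * hits W s'|}
          ∪ {s' | 3 / 2 * (n * p) ≤ hits W s'} := by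
      intro s' hs'
      by_contra hc
      simp only [Set.mem_union, Set.mem_ofPred_eq, not_or, not_le] at hc
      exact hs' hc
    refine (measure_mono hsub).trans ((measure_union_le _ _).trans
      ((add_le_add hcheb hchern).trans ?_))
    rw [← ENNReal.ofReal_add (by positivity) (by positivity)]
    refine ENNReal.ofReal_le_ofReal ?_
    have h1 : n * p / (2 / 3 * (n * p) * f) ^ 2 ≤ 1 / 4 := by
      rw [div_le_div_iff₀ (by positivity) (by norm_num)]
      nlinarith
    have h2 : Real.exp (-(n * p / 12)) ≤ 1 / 4 := by
      have h3 : (4 : ℝ) ≤ Real.exp (3 / 2) := by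
        rw [show (3 / 2 : ℝ) = (3 : ℕ) * (1 / 2) by norm_num, Real.exp_nat_mul]
        calc (4 : ℝ) ≤ (8 / 5) ^ 3 := by norm_num
          _ ≤ _ := pow_le_pow_left₀ (by norm_num) exp_half_bounds.1 3
      rw [Real.exp_neg, one_div]
      refine inv_anti₀ (by norm_num) (h3.trans (Real.exp_le_exp.2 ?_))
      linarith
    linarith
  refine hG.trans (measure_mono ?_)
  rintro s' ⟨hs', hU'⟩
  set U := hits W s
  set U' := hits W s'
  set A := hits (miss W x y h) s - hits (miss W x y h) s' with hA
  have hU0 : 0 < U := by linarith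
  -- Since `n p ≤ 2 U` and `U' < 3/2 n p ≤ 3 U`, the ghost count is controlled by `U`, and `K ≤ 2 U
  -- f²`.
  have hN : spread W (s, s') * K ≤ (10 / 3 * f * U) ^ 2 := by
    have h1 : spread W (s, s') ≤ 5 * U := (spread_le_hits_add_hits W (s, s')).trans (by
      change U + U' ≤ _
      linarith)
    calc spread W (s, s') * K ≤ (5 * U) * (2 * U * f ^ 2) := by
          refine mul_le_mul h1 ?_ (by linarith) (by positivity)
          exact hKf.trans (mul_le_mul_of_nonneg_right (by linarith) (sq_nonneg f))
      _ ≤ (10 / 3 * f * U) ^ 2 := by nlinarith [sq_nonneg (f * U)]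
  have hlt : 20 / 3 * f * U < |A| + |U - U'| := by
    have h1 : 2 / 3 * (n * p) * f ≤ 4 / 3 * f * U := by nlinarith
    have h2 := abs_sub_abs_le_abs_sub (hits (miss W x y h) s - q h * U)
      (hits (miss W x y h) s' - q h * U')
    have h3 : hits (miss W x y h) s - q h * U - (hits (miss W x y h) s' - q h * U')
        = A - q h * (U - U') := by rw [hA]; ring
    have h4 : |A - q h * (U - U')| ≤ |A| + |U - U'| := by
      refine (abs_sub _ _).trans ?_
      rw [abs_mul, abs_of_nonneg (hq h hh)]
      gcongr
      exact mul_le_of_le_one_left (abs_nonneg _) (hq' h hh)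
    rw [h3] at h2
    linarith
  have hlarge : ∀ z : ℝ, 10 / 3 * f * U < |z| → spread W (s, s') * K < z ^ 2 := by
    intro z hz
    rw [← sq_abs z]
    exact hN.trans_lt (by gcongr)
  -- The group sizes of the two samples differ too, so the gap is shared between the misses and the
  -- hits of `W`; one of them carries more than half of `20/3 f U`. This is why `deviation` has a
  -- second alternative.
  rcases lt_or_ge (10 / 3 * f * U) |A| with hc | hc
  · exact Or.inl ⟨h, hh, hlarge _ hc⟩
  · exact Or.inr (hlarge _ (by linarith))

end UniformDeviation

/-! ### Empirical quantities of a corrupted dataset -/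

section Corruption

variable {X : Type*} {n : ℕ}

/-- The marked points. -/
def markedPts (X : Type*) : Set (DataPoint X × Bool) := {ω | ω.2 = true}

/-- The unmarked points of the group `a`. -/
def cleanGroup (X : Type*) (a : Bool) : Set (DataPoint X × Bool) :=
  {ω | ω.1.2.1 = a} ∩ {ω | ω.2 = false}

/-- The unmarked points of the group `a` that `h` accepts. -/
abbrev cleanAccept (h : X → Bool) (a : Bool) : Set (DataPoint X × Bool) :=
  miss (cleanGroup X a) (fun ω => ω.1.1) (fun _ => false) h

/-- The points that `h` misclassifies. -/
abbrev misclassified (h : X → Bool) : Set (DataPoint X × Bool) :=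
  miss Set.univ (fun ω => ω.1.1) (fun ω => ω.1.2.2) h

lemma card_filter_eq_sum_real (p : Fin n → Prop) [DecidablePred p] :
    ((Finset.univ.filter p).card : ℝ) = ∑ i, if p i then 1 else 0 := by
  simp

variable {s : Fin n → DataPoint X × Bool} {S : Dataset X n}

lemma abs_empRisk_sub_le (hS : ∀ i, (s i).2 = false → S i = (s i).1) (hn : 0 < n)
    (h : X → Bool) {R r m : ℝ} (hr : |hits (misclassified h) s - R * n| ≤ r * n)
    (hm : hits (markedPts X) s ≤ m * n) :
    |empRisk S h - R| ≤ m + r := by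
  classical
  have hn' : (0 : ℝ) < n := by exact_mod_cast hn
  have h1 : |((Finset.univ.filter fun i => h (S i).1 ≠ (S i).2.2).card : ℝ)
      - hits (misclassified h) s| ≤ hits (markedPts X) s := by
    rw [card_filter_eq_sum_real, hits, hits, ← Finset.sum_sub_distrib]
    refine (Finset.abs_sum_le_sum_abs _ _).trans (Finset.sum_le_sum fun i _ => ?_)
    rcases hi : (s i).2 with _ | _
    · rw [hS i hi]
      simp [miss, markedPts, hi, Set.indicator_apply]
    · simp only [miss, markedPts, hi, Set.indicator_apply, Set.mem_ofPred_eq, Set.mem_inter_iff,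
        Set.mem_univ, true_and, Pi.one_apply, if_true]
      split_ifs <;> norm_num
  have h2 : empRisk S h - R
      = ((((Finset.univ.filter fun i => h (S i).1 ≠ (S i).2.2).card : ℝ)
      - hits (misclassified h) s) + (hits (misclassified h) s - R * n)) / n := by
    rw [empRisk]
    field_simp
    ring
  rw [h2, abs_div, abs_of_pos hn', div_le_iff₀ hn', add_mul]
  exact (abs_add_le _ _).trans (add_le_add (h1.trans hm) hr)

/-- The number of corrupted points in group `a`. -/
noncomputable def corruptCount (s : Fin n → DataPoint X × Bool) (S : Dataset X n) (a : Bool) : ℝ :=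
  ∑ i, if (s i).2 = true ∧ (S i).2.1 = a then 1 else 0

lemma corruptCount_nonneg (s : Fin n → DataPoint X × Bool) (S : Dataset X n) (a : Bool) :
    0 ≤ corruptCount s S a :=
  Finset.sum_nonneg fun i _ => by split_ifs <;> norm_num

lemma corruptCount_add (s : Fin n → DataPoint X × Bool) (S : Dataset X n) :
    corruptCount s S false + corruptCount s S true = hits (markedPts X) s := by
  classical
  rw [corruptCount, corruptCount, hits, ← Finset.sum_add_distrib]
  refine Finset.sum_congr rfl fun i _ => ?_
  rcases h1 : (s i).2 with _ | _ <;> rcases h2 : (S i).2.1 with _ | _ <;>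
    simp [markedPts, h1]

/-- The ratio is an average of the clean frequency `v / u` and the corrupted one, with weight `t /
(u + t)` on the latter, so corruption moves it by at most that weight. -/
lemma abs_ratio_sub_le {u v t w q ε : ℝ} (hu : 0 < u) (hv : 0 ≤ v) (hvu : v ≤ u) (hw : 0 ≤ w)
    (hwt : w ≤ t) (hq : |v - q * u| ≤ ε * u) : |(v + w) / (u + t) - q| ≤ t / (u + t) + ε := by
  have ht : 0 ≤ t := hw.trans hwt
  have hut : 0 < u + t := by linarith
  have h1 : |(v + w) / (u + t) - v / u| ≤ t / (u + t) := by
    have h : (v + w) / (u + t) - v / u = (u * w - v * t) / u / (u + t) := by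
      field_simp
      ring
    rw [h, abs_div, abs_div, abs_of_pos hut, abs_of_pos hu]
    gcongr
    rw [div_le_iff₀ hu, abs_le]
    constructor <;> nlinarith
  have h2 : |v / u - q| ≤ ε := by
    have h : v / u - q = (v - q * u) / u := by field_simp
    rwa [h, abs_div, abs_of_pos hu, div_le_iff₀ hu]
  calc |(v + w) / (u + t) - q| = |((v + w) / (u + t) - v / u) + (v / u - q)| := by ring_nf
    _ ≤ _ := (abs_add_le _ _).trans (add_le_add h1 h2)

lemma hits_mono {Ω : Type*} {V W : Set Ω} (hVW : V ⊆ W) (s : Fin n → Ω) : hits V s ≤ hits W s :=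
  Finset.sum_le_sum fun _ _ =>
    Set.indicator_le_indicator_of_subset hVW (fun _ => zero_le_one) _

lemma abs_empAcceptRate_sub_le (hS : ∀ i, (s i).2 = false → S i = (s i).1) (h : X → Bool)
    (a : Bool) {q ε : ℝ} (hu : 0 < hits (cleanGroup X a) s)
    (hq : |hits (cleanAccept h a) s - q * hits (cleanGroup X a) s|
      ≤ ε * hits (cleanGroup X a) s) :
    |empAcceptRate S h a - q|
      ≤ corruptCount s S a / (hits (cleanGroup X a) s + corruptCount s S a) + ε := by
  classical
  set w : ℝ := ∑ i, if (s i).2 = true ∧ h (S i).1 = true ∧ (S i).2.1 = a then 1 else 0 with hw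
  have h1 : ((Finset.univ.filter fun i => h (S i).1 = true ∧ (S i).2.1 = a).card : ℝ)
      = hits (cleanAccept h a) s + w := by
    rw [card_filter_eq_sum_real, hits, hw, ← Finset.sum_add_distrib]
    refine Finset.sum_congr rfl fun i _ => ?_
    rcases hi : (s i).2 with _ | _
    · rw [hS i hi]
      simp [miss, cleanGroup, Set.indicator_apply, hi, and_comm]
    · simp [miss, cleanGroup, hi]
  have h2 : ((Finset.univ.filter fun i => (S i).2.1 = a).card : ℝ)
      = hits (cleanGroup X a) s + corruptCount s S a := by
    rw [card_filter_eq_sum_real, hits, corruptCount, ← Finset.sum_add_distrib]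
    refine Finset.sum_congr rfl fun i _ => ?_
    rcases hi : (s i).2 with _ | _
    · rw [hS i hi]
      simp [cleanGroup, Set.indicator_apply, hi]
    · simp [cleanGroup, hi]
  rw [empAcceptRate, h1, h2]
  refine abs_ratio_sub_le hu (hits_nonneg _ _) (hits_mono (miss_subset _ _ _ _) s)
    (Finset.sum_nonneg fun i _ => by split_ifs <;> norm_num)
    (Finset.sum_le_sum fun i _ => ?_) hq
  split_ifs with h3 h4 <;> first | exact absurd ⟨h3.1, h3.2.2⟩ h4 | norm_num

/-- The function `t / (U + t)` is concave, so under a budget on `t₀ + t₁` the worst case is an even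
split; `key` is the tangent line at `T`. -/
lemma div_add_div_le_two_mul {u₀ u₁ t₀ t₁ U T : ℝ} (hU : 0 < U) (hT : 0 ≤ T) (hu₀ : U ≤ u₀)
    (hu₁ : U ≤ u₁) (ht₀ : 0 ≤ t₀) (ht₁ : 0 ≤ t₁) (ht : t₀ + t₁ ≤ 2 * T) :
    t₀ / (u₀ + t₀) + t₁ / (u₁ + t₁) ≤ 2 * (T / (U + T)) := by
  have key : ∀ u t : ℝ, U ≤ u → 0 ≤ t →
      t / (u + t) ≤ T / (U + T) + U / (U + T) ^ 2 * (t - T) := by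
    intro u t hu ht
    have h1 : t / (u + t) ≤ t / (U + t) := by gcongr
    have h2 : T / (U + T) + U / (U + T) ^ 2 * (t - T) - t / (U + t)
        = U * (t - T) ^ 2 / ((U + T) ^ 2 * (U + t)) := by
      have : U + T ≠ 0 := by positivity
      have : U + t ≠ 0 := by positivity
      field_simp
      ring
    have h3 : 0 ≤ U * (t - T) ^ 2 / ((U + T) ^ 2 * (U + t)) := by positivity
    linarith
  have h0 := key u₀ t₀ hu₀ ht₀
  have h1 := key u₁ t₁ hu₁ ht₁
  have h2 : 0 ≤ U / (U + T) ^ 2 * (2 * T - (t₀ + t₁)) :=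
    mul_nonneg (by positivity) (by linarith)
  nlinarith

lemma abs_empParityDev_sub_le (hS : ∀ i, (s i).2 = false → S i = (s i).1) (hn : 0 < n)
    (h : X → Bool) {α p₀ ε : ℝ} (hα : 0 ≤ α) (hp₀ : 0 < p₀) {q : Bool → ℝ}
    (hm : hits (markedPts X) s ≤ 3 / 2 * α * n)
    (hu : ∀ a, p₀ / 4 * n ≤ hits (cleanGroup X a) s)
    (hq : ∀ a, |hits (cleanAccept h a) s - q a * hits (cleanGroup X a) s|
      ≤ ε * hits (cleanGroup X a) s) :
    |empParityDev S h - abs (q false - q true)| ≤ deltaPar α p₀ + 2 * ε := by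
  have hn' : (0 : ℝ) < n := by exact_mod_cast hn
  have hU : 0 < p₀ / 4 * n := by positivity
  have h0 := abs_empAcceptRate_sub_le hS h false (hU.trans_le (hu _)) (hq _)
  have h1 := abs_empAcceptRate_sub_le hS h true (hU.trans_le (hu _)) (hq _)
  -- `T` is half of the budget of `3/2 α n` marks, which the adversary may divide between the
  -- groups; with `U = p₀ n / 4` the bound is exactly `deltaPar`.
  have hsum := div_add_div_le_two_mul (T := 3 / 4 * α * n) hU (by positivity) (hu false) (hu true)
    (corruptCount_nonneg s S false) (corruptCount_nonneg s S true)
    (by rw [corruptCount_add]; linarith)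
  have hdelta : 2 * (3 / 4 * α * n / (p₀ / 4 * n + 3 / 4 * α * n)) = deltaPar α p₀ := by
    rw [deltaPar]
    have : p₀ / 3 + α ≠ 0 := by positivity
    have : p₀ / 4 * n + 3 / 4 * α * n ≠ 0 := by positivity
    field_simp
  rw [hdelta] at hsum
  rw [empParityDev]
  refine (abs_abs_sub_abs_le_abs_sub _ _).trans ?_
  have h2 : empAcceptRate S h false - empAcceptRate S h true - (q false - q true)
      = (empAcceptRate S h false - q false) - (empAcceptRate S h true - q true) := by ring
  rw [h2]
  refine (abs_sub _ _).trans ?_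
  linarith

end Corruption

/-! ### Near-optimality -/

section NearOptimality

variable {X : Type*} {n : ℕ}

/-- An empirical objective sees only the predictions on the `n` sample points, hence takes finitely
many values even when `H` is infinite. -/
lemma exists_isMinOn_of_patterns {H : Set (X → Bool)} (hH : H.Nonempty) (u : Fin n → X)
    (F : (Fin n → Bool) → ℝ) : ∃ g ∈ H, IsMinOn (fun h : X → Bool => F fun i => h (u i)) H g := by
  have hfin : ((fun (h : X → Bool) i => h (u i)) '' H).Finite := Set.toFinite _
  obtain ⟨_, ⟨g, hg, rfl⟩, hmin⟩ := Set.exists_min_image _ F hfin (hH.image _)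
  exact ⟨g, hg, fun h hh => hmin _ ⟨h, hh, rfl⟩⟩

lemma exists_isMinOn_empRisk {H : Set (X → Bool)} (hH : H.Nonempty) (S : Dataset X n) :
    ∃ g ∈ H, IsMinOn (empRisk S) H g :=
  exists_isMinOn_of_patterns hH (fun i => (S i).1) fun β =>
    (Finset.univ.filter fun i => β i ≠ (S i).2.2).card / (n : ℝ)

lemma exists_isMinOn_empParityDev {H : Set (X → Bool)} (hH : H.Nonempty) (S : Dataset X n) :
    ∃ g ∈ H, IsMinOn (empParityDev S) H g :=
  exists_isMinOn_of_patterns hH (fun i => (S i).1) fun β =>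
    |(Finset.univ.filter fun i => β i = true ∧ (S i).2.1 = false).card /
        ((Finset.univ.filter fun i => (S i).2.1 = false).card : ℝ)
      - (Finset.univ.filter fun i => β i = true ∧ (S i).2.1 = true).card /
        ((Finset.univ.filter fun i => (S i).2.1 = true).card : ℝ)|

lemma exists_isComponentWise {H : Set (X → Bool)} (hH : H.Nonempty) (d : ℕ) (α p₀ δ : ℝ) :
    ∃ L : Learner H, IsComponentWise H d α p₀ δ L := by
  classical
  obtain ⟨h₀, hh₀⟩ := hH
  refine ⟨fun n S =>
    if hne : (nearOptRisk H d α δ S ∩ nearOptParity H d α p₀ δ S).Nonempty then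
      ⟨hne.choose, hne.choose_spec.1.1⟩ else ⟨h₀, hh₀⟩, fun n S hne => ?_⟩
  simp only [dif_pos hne]
  exact hne.choose_spec

/-- Near-optimality of a hypothesis that is nearly optimal for a uniform approximation. -/
lemma sub_le_of_uniform_approx {ι : Type*} {H : Set ι} {F G : ι → ℝ} {ε : ℝ}
    (hFG : ∀ h ∈ H, |F h - G h| ≤ ε) {g g₀ h : ι} (hg : g ∈ H) (hh : h ∈ H)
    (hmin : IsMinOn F H g₀) (hle : F h - F g₀ ≤ 2 * ε) : G h - G g ≤ 4 * ε := by
  have h1 := abs_le.1 (hFG h hh)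
  have h2 := abs_le.1 (hFG g hg)
  have h3 : F g₀ ≤ F g := hmin hg
  linarith [h1.1, h2.2]

lemma sub_min_le_of_uniform_approx {ι : Type*} {H : Set ι} {F G : ι → ℝ} {ε : ℝ}
    (hFG : ∀ h ∈ H, |F h - G h| ≤ ε) {g g₀ : ι} (hg : g ∈ H) (hg₀ : g₀ ∈ H)
    (hopt : ∀ h ∈ H, G g ≤ G h) : F g - F g₀ ≤ 2 * ε := by
  have h1 := abs_le.1 (hFG g₀ hg₀)
  have h2 := abs_le.1 (hFG g hg)
  linarith [h1.1, h2.2, hopt g₀ hg₀]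

/-- A component-wise learner is nearly optimal in both objectives on every dataset whose empirical
objectives are uniformly close to the true ones. -/
lemma IsComponentWise.sub_le [MeasurableSpace X] {H : Set (X → Bool)} (hH : H.Nonempty) {d : ℕ}
    {α p₀ δ : ℝ} {L : Learner H} (hL : IsComponentWise H d α p₀ δ L)
    {P : Measure (DataPoint X)} {hstar : X → Bool} (hstarH : hstar ∈ H)
    (hopt : ∀ h ∈ H, risk P hstar ≤ risk P h ∧ parityDev P hstar ≤ parityDev P h)
    {S : Dataset X n}
    (hrisk : ∀ h ∈ H, |empRisk S h - risk P h| ≤ 3 / 2 * α + 2 * riskErr d δ n)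
    (hpar : ∀ h ∈ H, |empParityDev S h - parityDev P h|
      ≤ deltaPar α p₀ + 16 * parityErr d α p₀ δ n) :
    risk P (L n S) - risk P hstar ≤ 6 * α + 8 * riskErr d δ n ∧
      parityDev P (L n S) - parityDev P hstar
        ≤ 4 * deltaPar α p₀ + 64 * parityErr d α p₀ δ n := by
  obtain ⟨gr, hgr, hgrmin⟩ := exists_isMinOn_empRisk hH S
  obtain ⟨gp, hgp, hgpmin⟩ := exists_isMinOn_empParityDev hH S
  -- The tolerances of the two near-optimal sets are exactly twice the uniform approximation errors,
  -- so `hstar` lies in both.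
  have h1 := sub_min_le_of_uniform_approx hrisk hstarH hgr fun h hh => (hopt h hh).1
  have h2 := sub_min_le_of_uniform_approx hpar hstarH hgp fun h hh => (hopt h hh).2
  obtain ⟨⟨hLH, g, -, hgmin, hle⟩, ⟨-, g', -, hgmin', hle'⟩⟩ := hL n S
    ⟨hstar, ⟨hstarH, gr, hgr, hgrmin, by linarith⟩, ⟨hstarH, gp, hgp, hgpmin, by linarith⟩⟩
  have h3 := sub_le_of_uniform_approx hrisk hstarH hLH hgmin (by linarith)
  have h4 := sub_le_of_uniform_approx hpar hstarH hLH hgmin' (by linarith)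
  constructor <;> linarith

end NearOptimality

/-! ### The law of the marked points -/

section Law

variable {X : Type*} [MeasurableSpace X]

lemma isProbabilityMeasure_markLaw {α : ℝ} (hα : 0 ≤ α) (hα' : α ≤ 1) :
    IsProbabilityMeasure (markLaw α) := by
  constructor
  simp only [markLaw, Measure.add_apply, Measure.smul_apply, measure_univ, smul_eq_mul, mul_one]
  rw [← ENNReal.ofReal_add hα (by linarith)]
  simp

lemma markLaw_real_true {α : ℝ} (hα : 0 ≤ α) : (markLaw α).real {b | b = true} = α := by
  rw [measureReal_def, markLaw]
  simp [hα]

lemma markLaw_real_false {α : ℝ} (hα' : α ≤ 1) : (markLaw α).real {b | b = false} = 1 - α := by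
  rw [measureReal_def, markLaw]
  simp [hα']

lemma measurableSet_group (a : Bool) : MeasurableSet {z : DataPoint X | z.2.1 = a} :=
  (measurable_fst.comp measurable_snd) (measurableSet_singleton a)

lemma measurableSet_cleanGroup (a : Bool) : MeasurableSet (cleanGroup X a) :=
  (measurable_fst (measurableSet_group a)).inter (measurable_snd (measurableSet_singleton false))

lemma measurableSet_markedPts : MeasurableSet (markedPts X) :=
  measurable_snd (measurableSet_singleton true)

variable (P : Measure (DataPoint X)) [IsProbabilityMeasure P] {α : ℝ}

lemma groupProb_add : groupProb P false + groupProb P true = 1 := by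
  have h : {z : DataPoint X | z.2.1 = true} = {z : DataPoint X | z.2.1 = false}ᶜ := by
    ext z
    simp
  rw [groupProb, groupProb, h, probReal_add_probReal_compl (measurableSet_group false)]

lemma real_markedPts (hα : 0 ≤ α) : (P.prod (markLaw α)).real (markedPts X) = α := by
  have h : markedPts X = Set.univ ×ˢ {b | b = true} := by
    ext ω
    simp [markedPts]
  rw [h, measureReal_prod_prod, markLaw_real_true hα, probReal_univ, one_mul]

omit [IsProbabilityMeasure P] in
lemma real_cleanGroup (hα' : α ≤ 1) (a : Bool) :
    (P.prod (markLaw α)).real (cleanGroup X a) = (1 - α) * groupProb P a := by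
  have h : cleanGroup X a = {z : DataPoint X | z.2.1 = a} ×ˢ {b | b = false} := by
    ext ω
    simp [cleanGroup]
  rw [h, measureReal_prod_prod, markLaw_real_false hα', groupProb, mul_comm]

-- Marks are independent of the data, so the factor `1 - α` cancels and the conditional acceptance
-- rate among unmarked points is the original one.
omit [IsProbabilityMeasure P] in
lemma real_cleanAccept (hα' : α ≤ 1) (h : X → Bool) (a : Bool) (ha : 0 < groupProb P a) :
    (P.prod (markLaw α)).real (cleanAccept h a)
      = acceptRate P h a * (P.prod (markLaw α)).real (cleanGroup X a) := by
  have h1 : cleanAccept h a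
      = ({z : DataPoint X | z.2.1 = a} ∩ {z | h z.1 = true}) ×ˢ {b | b = false} := by
    ext ω
    simp only [miss, cleanGroup, Set.mem_inter_iff, Set.mem_prod, Set.mem_ofPred_eq, ne_eq,
      Bool.not_eq_false]
    tauto
  have h2 : P.real {z : DataPoint X | z.2.1 = a} ≠ 0 := ha.ne'
  rw [real_cleanGroup P hα', h1, measureReal_prod_prod, markLaw_real_false hα', acceptRate,
    groupProb, measureReal_def (μ := P[|_]), cond_apply (measurableSet_group a),
    ENNReal.toReal_mul, ENNReal.toReal_inv, ← measureReal_def, ← measureReal_def]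
  field_simp

omit [IsProbabilityMeasure P] in
lemma real_misclassified [IsProbabilityMeasure (markLaw α)] (h : X → Bool) :
    (P.prod (markLaw α)).real (misclassified h) = risk P h := by
  have h1 : misclassified h = {z : DataPoint X | h z.1 ≠ z.2.2} ×ˢ (Set.univ : Set Bool) := by
    ext ω
    simp [miss]
  rw [h1, measureReal_prod_prod, probReal_univ, mul_one, risk]

omit [IsProbabilityMeasure P] in
lemma map_input [IsProbabilityMeasure (markLaw α)] :
    (P.prod (markLaw α)).map (fun ω => ω.1.1) = P.map Prod.fst := by
  have h := Measure.map_map (μ := P.prod (markLaw α)) (f := Prod.fst) (g := Prod.fst)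
    measurable_fst measurable_fst
  rw [Measure.map_fst_prod] at h
  rw [measure_univ, one_smul] at h
  exact h.symm

/-- Pairing the clean points with their marks gives an i.i.d. sample. -/
lemma measurePreserving_markedSample [IsProbabilityMeasure (markLaw α)]
    (𝒜 : MaliciousAdversary X) (n : ℕ) :
    MeasurePreserving (fun (ω : 𝒜.Outcome n) i => (ω.1 i, ω.2.1 i)) (𝒜.law P α n)
      (Measure.pi fun _ => P.prod (markLaw α)) := by
  have h1 := (measurePreserving_arrowProdEquivProdArrow (DataPoint X) Bool (Fin n) (fun _ => P)
    fun _ => markLaw α).symm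
  exact h1.comp ((MeasurePreserving.id _).prod measurePreserving_fst)

end Law

/-! ### The sample size condition -/

section Numerics

variable {d n : ℕ} {δ : ℝ}

lemma exp_natCast_mul_log {c : ℝ} (hc : d ≠ 0 → 0 < c) : Real.exp (d * Real.log c) = c ^ d := by
  rcases Nat.eq_zero_or_pos d with rfl | hd
  · simp
  · rw [Real.exp_nat_mul, Real.exp_log (hc hd.ne')]

lemma log_div_pos_bound {c : ℝ} (hc : 0 < c) (hδ : 0 < δ) (hδ' : δ < 1) :
    Real.log c ≤ Real.log (c / δ) := by
  refine Real.log_le_log hc ?_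
  rw [le_div_iff₀ hδ]
  nlinarith

lemma log_sixteen_ge : 9 / 4 ≤ Real.log 16 := by
  have h : Real.log 16 = 4 * Real.log 2 := by
    rw [show (16 : ℝ) = 2 ^ 4 by norm_num, Real.log_pow]
    norm_num
  linarith [Real.log_two_gt_d9]

lemma log_ninety_six_ge : 9 / 2 ≤ Real.log 96 := by
  have h : 9 ≤ Real.log (96 ^ 2) := by
    rw [Real.le_log_iff_exp_le (by norm_num), show (9 : ℝ) = (9 : ℕ) * 1 by norm_num,
      Real.exp_nat_mul]
    calc Real.exp 1 ^ 9 ≤ (2.7183 : ℝ) ^ 9 :=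
          pow_le_pow_left₀ (Real.exp_pos 1).le (by linarith [Real.exp_one_lt_d9]) 9
      _ ≤ _ := by norm_num
  rw [Real.log_pow] at h
  norm_num at h
  linarith

lemma natCast_mul_log_nonneg {c : ℝ} (hc : d ≠ 0 → 1 ≤ c) : 0 ≤ d * Real.log c := by
  rcases Nat.eq_zero_or_pos d with rfl | hd
  · simp
  · exact mul_nonneg (Nat.cast_nonneg d) (Real.log_nonneg (hc hd.ne'))

lemma one_le_two_exp_mul_div (hdn : d ≤ 2 * n) (hd : d ≠ 0) : 1 ≤ 2 * Real.exp 1 * n / d := by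
  have hd' : (0 : ℝ) < d := by exact_mod_cast Nat.pos_of_ne_zero hd
  have hdn' : (d : ℝ) ≤ 2 * n := by exact_mod_cast hdn
  rw [le_div_iff₀ hd']
  nlinarith [Real.add_one_le_exp (1 : ℝ)]

lemma growth_mul_exp_parity (hdn : d ≤ 2 * n) (hδ : 0 < δ) :
    8 * (2 * Real.exp 1 * n / d) ^ d
      * Real.exp (-(2 * d * Real.log (2 * Real.exp 1 * n / d) + 2 * Real.log (96 / δ)) / 2)
      = δ / 12 := by
  rw [← exp_natCast_mul_log fun h => zero_lt_one.trans_le (one_le_two_exp_mul_div hdn h),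
    show ∀ a b : ℝ, -(2 * d * a + 2 * b) / 2 = -(d * a) + -b by intros; ring, Real.exp_add,
    Real.exp_neg (Real.log _), Real.exp_log (by positivity), Real.exp_neg]
  have := (Real.exp_pos (d * Real.log (2 * Real.exp 1 * n / d))).ne'
  field_simp
  norm_num

/-- For `1 ≤ d ≤ n` one has `log (e n / d) ≥ 1 > log 2`, so the coefficient `8` in `riskErr` more
than pays for the growth function on `2n` points. -/
lemma growth_mul_exp_risk_le (hdn : d ≤ n) (hδ : 0 < δ) :
    8 * (2 * Real.exp 1 * n / d) ^ d
      * Real.exp (-(8 * d * Real.log (Real.exp 1 * n / d) + 2 * Real.log (16 / δ)) / 2)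
      ≤ δ / 2 := by
  have key : d * Real.log (2 * Real.exp 1 * n / d) ≤ 4 * (d * Real.log (Real.exp 1 * n / d)) := by
    rcases Nat.eq_zero_or_pos d with rfl | hd
    · simp
    have hd' : (0 : ℝ) < d := by exact_mod_cast hd
    have hdn' : (d : ℝ) ≤ n := by exact_mod_cast hdn
    have hn' : (0 : ℝ) < n := hd'.trans_le hdn'
    have h1 : 1 ≤ Real.log (Real.exp 1 * n / d) := by
      rw [Real.le_log_iff_exp_le (by positivity), le_div_iff₀ hd']
      gcongr
    have h2 : Real.log (2 * Real.exp 1 * n / d)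
        = Real.log 2 + Real.log (Real.exp 1 * n / d) := by
      rw [← Real.log_mul (by norm_num) (by positivity)]
      ring_nf
    rw [h2]
    nlinarith [Real.log_two_lt_d9]
  rw [← exp_natCast_mul_log fun h =>
    zero_lt_one.trans_le (one_le_two_exp_mul_div (hdn.trans (by omega)) h), mul_assoc,
    ← Real.exp_add]
  calc _ ≤ 8 * Real.exp (-Real.log (16 / δ)) := by
        gcongr
        linarith
    _ = δ / 2 := by
        rw [Real.exp_neg, Real.exp_log (by positivity)]
        field_simp
        norm_num

lemma riskErr_sq (hdn : d ≤ n) (hn : 0 < n) (hδ : 0 < δ) (hδ' : δ < 1) :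
    n * riskErr d δ n ^ 2 = 8 * d * Real.log (Real.exp 1 * n / d) + 2 * Real.log (16 / δ) := by
  have hn' : (0 : ℝ) < n := by exact_mod_cast hn
  have h1 : 0 ≤ d * Real.log (Real.exp 1 * n / d) := natCast_mul_log_nonneg fun hd => by
    have hd' : (0 : ℝ) < d := by exact_mod_cast Nat.pos_of_ne_zero hd
    have hdn' : (d : ℝ) ≤ n := by exact_mod_cast hdn
    rw [le_div_iff₀ hd']
    nlinarith [Real.add_one_le_exp (1 : ℝ)]
  have h2 := log_div_pos_bound (c := 16) (by norm_num) hδ hδ'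
  have h3 := log_sixteen_ge
  rw [riskErr, Real.sq_sqrt (div_nonneg (by nlinarith) hn'.le)]
  field_simp

/-- If `n < d` the bound on the risk is trivial. -/
lemma half_le_riskErr (hdn : d ≤ 2 * n) (hnd : n < d) (hn : 0 < n) (hδ : 0 < δ) (hδ' : δ < 1) :
    1 / 2 ≤ riskErr d δ n := by
  have hn' : (0 : ℝ) < n := by exact_mod_cast hn
  have hd' : (n : ℝ) < d := by exact_mod_cast hnd
  have hd0 : (0 : ℝ) < d := hn'.trans hd'
  have hdn' : (d : ℝ) ≤ 2 * n := by exact_mod_cast hdn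
  have h1 : 3 / 10 ≤ Real.log (Real.exp 1 * n / d) := by
    have h2 : Real.log (Real.exp 1 / 2) = 1 - Real.log 2 := by
      rw [Real.log_div (Real.exp_pos 1).ne' (by norm_num), Real.log_exp]
    have h3 : Real.log (Real.exp 1 / 2) ≤ Real.log (Real.exp 1 * n / d) := by
      refine Real.log_le_log (by positivity) ?_
      rw [div_le_div_iff₀ (by norm_num) hd0]
      nlinarith [Real.exp_pos 1]
    linarith [Real.log_two_lt_d9]
  have h2 := log_div_pos_bound (c := 16) (by norm_num) hδ hδ'
  have h3 := log_sixteen_ge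
  refine Real.le_sqrt_of_sq_le ?_
  rw [le_div_iff₀ hn']
  nlinarith

lemma parityErr_sq {α p₀ : ℝ} (hα' : α < 1) (hp₀ : 0 < p₀) (hdn : d ≤ 2 * n) (hn : 0 < n)
    (hδ : 0 < δ) (hδ' : δ < 1) :
    9 ≤ 2 * d * Real.log (2 * Real.exp 1 * n / d) + 2 * Real.log (96 / δ) ∧
    n * ((1 - α) * p₀) * parityErr d α p₀ δ n ^ 2
      = 2 * d * Real.log (2 * Real.exp 1 * n / d) + 2 * Real.log (96 / δ) := by
  have hn' : (0 : ℝ) < n := by exact_mod_cast hn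
  have hα1 : 0 < 1 - α := by linarith
  have h1 : 0 ≤ d * Real.log (2 * Real.exp 1 * n / d) :=
    natCast_mul_log_nonneg fun hd => one_le_two_exp_mul_div hdn hd
  have h2 := log_div_pos_bound (c := 96) (by norm_num) hδ hδ'
  have h3 := log_ninety_six_ge
  have h4 : 9 ≤ 2 * d * Real.log (2 * Real.exp 1 * n / d) + 2 * Real.log (96 / δ) := by nlinarith
  refine ⟨h4, ?_⟩
  rw [parityErr, Real.sq_sqrt (div_nonneg (by linarith) (by positivity))]
  field_simp

end Numerics

/-! ### The exceptional events -/

section ExceptionalEvents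

variable {X : Type*} [MeasurableSpace X] {H : Set (X → Bool)} {d n : ℕ} {α p₀ δ : ℝ}

lemma measure_many_marks_le (P : Measure (DataPoint X)) [IsProbabilityMeasure P]
    [IsProbabilityMeasure (markLaw α)] (hα : 0 ≤ α) (hδ : 0 < δ)
    (hn : 12 * Real.log (12 / δ) / α ≤ n) :
    (Measure.pi fun _ : Fin n => P.prod (markLaw α))
      {s | ¬ hits (markedPts X) s ≤ 3 / 2 * α * n} ≤ ENNReal.ofReal (δ / 12) := by
  have hreal := real_markedPts P hα
  -- For `α = 0` the sample size condition reads `0 ≤ n` because division by zero gives `0`; almost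
  -- surely there are no marks.
  rcases hα.eq_or_lt with rfl | hαpos
  · refine le_of_eq_of_le ?_ zero_le
    have h0 : (P.prod (markLaw 0)) (markedPts X) = 0 := by
      rwa [measureReal_eq_zero_iff] at hreal
    have hae : ∀ᵐ ω ∂(P.prod (markLaw 0)), ω ∉ markedPts X := measure_eq_zero_iff_ae_notMem.1 h0
    have hall : ∀ᵐ s ∂(Measure.pi fun _ : Fin n => P.prod (markLaw 0)),
        ∀ i, s i ∉ markedPts X :=
      ae_all_iff.2 fun i =>
        (measurePreserving_eval (fun _ : Fin n => P.prod (markLaw 0)) i).quasiMeasurePreserving.ae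
          hae
    refine measure_mono_null ?_ hall
    intro s hs hs'
    have hs'' : ∀ i, s i ∉ markedPts X := hs'
    exact hs (by simp [hits, hs''])
  · have h := measure_hits_ge_le (n := n) (P.prod (markLaw α)) (measurableSet_markedPts (X := X))
    rw [hreal] at h
    refine (measure_mono fun s hs => ?_).trans (h.trans (ENNReal.ofReal_le_ofReal ?_))
    · have hs' := not_le.1 hs
      change 3 / 2 * (n * α) ≤ hits (markedPts X) s
      linarith
    · rw [div_le_iff₀ hαpos] at hn
      calc Real.exp (-(n * α / 12)) ≤ Real.exp (-Real.log (12 / δ)) :=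
            Real.exp_le_exp.2 (by linarith)
        _ = δ / 12 := by rw [Real.exp_neg, Real.exp_log (by positivity), inv_div]

lemma measure_few_cleanGroup_le (P : Measure (DataPoint X)) [IsProbabilityMeasure P]
    [IsProbabilityMeasure (markLaw α)] (hα' : α < 1) (hδ : 0 < δ) {a : Bool}
    (ha : p₀ ≤ groupProb P a) (hn : 8 * Real.log (16 / δ) ≤ n * ((1 - α) * p₀)) :
    (Measure.pi fun _ : Fin n => P.prod (markLaw α))
      {s | ¬ n * ((1 - α) * groupProb P a) / 2 ≤ hits (cleanGroup X a) s}
      ≤ ENNReal.ofReal (δ / 16) := by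
  have h := measure_hits_le_le (n := n) (P.prod (markLaw α)) (measurableSet_cleanGroup (X := X) a)
  rw [real_cleanGroup P hα'.le] at h
  refine (measure_mono fun s hs => (not_le.1 hs).le).trans
    (h.trans (ENNReal.ofReal_le_ofReal ?_))
  have h1 : n * ((1 - α) * p₀) ≤ n * ((1 - α) * groupProb P a) := by
    have : 0 < 1 - α := by linarith
    gcongr
  calc _ ≤ Real.exp (-Real.log (16 / δ)) := Real.exp_le_exp.2 (by linarith)
    _ = δ / 16 := by rw [Real.exp_neg, Real.exp_log (by positivity), inv_div]

lemma measure_acceptRate_deviation_le (P : Measure (DataPoint X)) [IsProbabilityMeasure P]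
    [IsProbabilityMeasure (markLaw α)] (hH : H.Nonempty) (hd : vcDim H = d)
    (hreg : RegularClass H (P.map Prod.fst)) (hα' : α < 1) (hp₀ : 0 < p₀) (hδ : 0 < δ)
    (hδ' : δ < 1) (hdn : d ≤ 2 * n) (hn0 : 0 < n) {a : Bool} (ha : p₀ ≤ groupProb P a)
    (hn : 8 * Real.log (16 / δ) ≤ n * ((1 - α) * p₀)) :
    (Measure.pi fun _ : Fin n => P.prod (markLaw α))
      {s | n * ((1 - α) * groupProb P a) / 2 ≤ hits (cleanGroup X a) s ∧
        ∃ h ∈ H, 8 * parityErr d α p₀ δ n * hits (cleanGroup X a) s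
          < |hits (cleanAccept h a) s - acceptRate P h a * hits (cleanGroup X a) s|}
      ≤ ENNReal.ofReal (δ / 12) := by
  obtain ⟨hK, hKf⟩ := parityErr_sq (d := d) hα' hp₀ hdn hn0 hδ hδ'
  have hα1 : 0 < 1 - α := by linarith
  have hle : n * ((1 - α) * p₀) ≤ n * ((1 - α) * groupProb P a) := by gcongr
  have hf : 0 < parityErr d α p₀ δ n := by
    refine lt_of_le_of_ne (Real.sqrt_nonneg _) fun h0 => ?_
    rw [← h0] at hKf
    linarith
  -- Since `log (16 / δ) ≥ 9/4`, the sample size condition gives an expected clean group size of at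
  -- least `8 * 9/4 = 18`.
  have hlog := (log_sixteen_ge).trans (log_div_pos_bound (c := 16) (by norm_num) hδ hδ')
  have hreal := real_cleanGroup P hα'.le a
  have : IsProbabilityMeasure (P[|{z : DataPoint X | z.2.1 = a}]) := by
    refine cond_isProbabilityMeasure fun h0 => ?_
    have h1 : groupProb P a = 0 := by rw [groupProb, measureReal_def, h0, ENNReal.toReal_zero]
    linarith
  have h := measure_exists_miss_relative_deviation_le (n := n) (P.prod (markLaw α)) hH hd hdn
    (measurableSet_cleanGroup (X := X) a) (measurable_fst.comp measurable_fst)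
    (y := fun _ => false) measurable_const (by rwa [← map_input P (α := α)] at hreg)
    (q := fun h => acceptRate P h a) (fun h _ => measureReal_nonneg)
    (fun h _ => measureReal_le_one)
    (fun h _ => real_cleanAccept P hα'.le h a (hp₀.trans_le ha)) hf hK
    (by
      rw [hreal, ← hKf]
      gcongr)
    (by
      rw [hreal]
      linarith)
  rw [hreal, growth_mul_exp_parity hdn hδ] at h
  exact h

lemma measure_risk_deviation_le (P : Measure (DataPoint X)) [IsProbabilityMeasure P]
    [IsProbabilityMeasure (markLaw α)] (hH : H.Nonempty) (hd : vcDim H = d)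
    (hreg : RegularClass H (P.map Prod.fst)) (hδ : 0 < δ)
    (hδ' : δ < 1) (hdn : d ≤ 2 * n) (hn0 : 0 < n) :
    (Measure.pi fun _ : Fin n => P.prod (markLaw α))
      {s | ∃ h ∈ H, 2 * riskErr d δ n * n < |hits (misclassified h) s - risk P h * n|}
      ≤ ENNReal.ofReal (δ / 2) := by
  have hn' : (0 : ℝ) < n := by exact_mod_cast hn0
  rcases lt_or_ge n d with hnd | hnd
  · have hr := half_le_riskErr hdn hnd hn0 hδ hδ'
    refine le_of_eq_of_le ?_ zero_le
    convert measure_empty (μ := Measure.pi fun _ : Fin n => P.prod (markLaw α))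
    refine Set.eq_empty_of_forall_notMem fun s hs => ?_
    obtain ⟨h, -, hlt⟩ := hs
    have h1 := hits_nonneg (misclassified h) s
    have h2 := hits_le (misclassified h) s
    have h3 : 0 ≤ risk P h := measureReal_nonneg
    have h4 : risk P h ≤ 1 := measureReal_le_one
    have h5 : |hits (misclassified h) s - risk P h * n| ≤ n := by
      rw [abs_le]
      constructor <;> nlinarith
    nlinarith
  · have hsq := riskErr_sq hnd hn0 hδ hδ'
    have hlog := (log_sixteen_ge).trans (log_div_pos_bound (c := 16) (by norm_num) hδ hδ')
    have hK : 2 ≤ n * riskErr d δ n ^ 2 := by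
      have h1 : 0 ≤ d * Real.log (Real.exp 1 * n / d) := natCast_mul_log_nonneg fun hd => by
        have hd' : (0 : ℝ) < d := by exact_mod_cast Nat.pos_of_ne_zero hd
        have hdn' : (d : ℝ) ≤ n := by exact_mod_cast hnd
        rw [le_div_iff₀ hd']
        nlinarith [Real.add_one_le_exp (1 : ℝ)]
      rw [hsq]
      nlinarith
    have hr : 0 < riskErr d δ n := by
      refine lt_of_le_of_ne (Real.sqrt_nonneg _) fun h0 => ?_
      rw [← h0] at hK
      norm_num at hK
    have h := measure_exists_miss_deviation_le (n := n) (P.prod (markLaw α)) hH hd hdn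
      (measurable_fst.comp measurable_fst)
      (y := fun ω => ω.1.2.2) (measurable_snd.comp (measurable_snd.comp measurable_fst))
      (by rwa [← map_input P (α := α)] at hreg) hr hK
    rw [hsq] at h
    refine le_trans (measure_mono ?_) (h.trans
      (ENNReal.ofReal_le_ofReal (growth_mul_exp_risk_le hnd hδ)))
    rintro s ⟨f, hf, hlt⟩
    refine ⟨f, hf, ?_⟩
    rw [← real_misclassified (α := α) P f] at hlt
    exact hlt

end ExceptionalEvents

/-- Every component-wise learner is nearly optimal in both objectives, with high probability. -/
theorem IsComponentWise.measure_failure_le {X : Type*} [MeasurableSpace X] {H : Set (X → Bool)}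
    (hH : H.Nonempty) {d : ℕ} (hd : vcDim H = d) {α p₀ δ : ℝ} (hα : 0 ≤ α) (hα' : α < 1 / 2)
    (hp₀ : 0 < p₀) (hp₀' : p₀ ≤ 1 / 2) (hδ : 0 < δ) (hδ' : δ < 1) {L : Learner H}
    (hL : IsComponentWise H d α p₀ δ L) (P : Measure (DataPoint X)) [IsProbabilityMeasure P]
    (hP : groupProb P false = p₀) (hreg : RegularClass H (P.map Prod.fst)) {hstar : X → Bool}
    (hstarH : hstar ∈ H)
    (hopt : ∀ h ∈ H, risk P hstar ≤ risk P h ∧ parityDev P hstar ≤ parityDev P h)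
    (𝒜 : MaliciousAdversary X) {n : ℕ}
    (hn : max (max (8 * Real.log (16 / δ) / ((1 - α) * p₀)) (12 * Real.log (12 / δ) / α))
      ((d : ℝ) / 2) ≤ n) :
    𝒜.law P α n
      {ω | ¬ (risk P (L n (𝒜.corrupted ω)) - risk P hstar ≤ 6 * α + 8 * riskErr d δ n ∧
        parityDev P (L n (𝒜.corrupted ω)) - parityDev P hstar
          ≤ 4 * deltaPar α p₀ + 64 * parityErr d α p₀ δ n)}
      ≤ ENNReal.ofReal δ := by
  rw [max_le_iff, max_le_iff] at hn
  obtain ⟨⟨hn1, hn2⟩, hn3⟩ := hn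
  have hα1 : 0 < 1 - α := by linarith
  have := isProbabilityMeasure_markLaw hα (by linarith)
  rw [div_le_iff₀ (by positivity)] at hn1
  have hdn : d ≤ 2 * n := by
    rw [div_le_iff₀ (by norm_num)] at hn3
    have : (d : ℝ) ≤ (2 * n : ℕ) := by push_cast; linarith
    exact_mod_cast this
  have hlog := log_sixteen_ge.trans (log_div_pos_bound (c := 16) (by norm_num) hδ hδ')
  have hn0 : 0 < n := by
    rcases Nat.eq_zero_or_pos n with rfl | h
    · simp only [Nat.cast_zero, zero_mul] at hn1
      linarith
    · exact h
  -- The group `false` is the rarer one because `p₀ ≤ 1/2`.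
  have hgroup : ∀ a, p₀ ≤ groupProb P a := by
    have h1 := groupProb_add P
    rintro (_ | _) <;> linarith
  set Q := P.prod (markLaw α)
  set μ := Measure.pi fun _ : Fin n => Q
  set M : Set (Fin n → DataPoint X × Bool) := {s | ¬ hits (markedPts X) s ≤ 3 / 2 * α * n}
  set F : Bool → Set (Fin n → DataPoint X × Bool) := fun a =>
    {s | ¬ n * ((1 - α) * groupProb P a) / 2 ≤ hits (cleanGroup X a) s}
  set D : Bool → Set (Fin n → DataPoint X × Bool) := fun a =>
    {s | n * ((1 - α) * groupProb P a) / 2 ≤ hits (cleanGroup X a) s ∧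
        ∃ h ∈ H, 8 * parityErr d α p₀ δ n * hits (cleanGroup X a) s
          < |hits (cleanAccept h a) s - acceptRate P h a * hits (cleanGroup X a) s|}
  set R : Set (Fin n → DataPoint X × Bool) :=
    {s | ∃ h ∈ H, 2 * riskErr d δ n * n < |hits (misclassified h) s - risk P h * n|}
  have hM : μ M ≤ ENNReal.ofReal (δ / 12) := measure_many_marks_le P hα hδ hn2
  have hF : ∀ a, μ (F a) ≤ ENNReal.ofReal (δ / 16) := fun a =>
    measure_few_cleanGroup_le P (by linarith) hδ (hgroup a) hn1
  have hD : ∀ a, μ (D a) ≤ ENNReal.ofReal (δ / 12) := fun a =>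
    measure_acceptRate_deviation_le P hH hd hreg (by linarith) hp₀ hδ hδ' hdn hn0 (hgroup a) hn1
  have hR : μ R ≤ ENNReal.ofReal (δ / 2) :=
    measure_risk_deviation_le P hH hd hreg hδ hδ' hdn hn0
  set B := M ∪ ((F false ∪ F true) ∪ ((D false ∪ D true) ∪ R))
  have hB : μ B ≤ ENNReal.ofReal δ := by
    have h1 : μ B ≤ ENNReal.ofReal (δ / 12) + ((ENNReal.ofReal (δ / 16) + ENNReal.ofReal (δ / 16))
        + ((ENNReal.ofReal (δ / 12) + ENNReal.ofReal (δ / 12)) + ENNReal.ofReal (δ / 2))) := by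
      refine (measure_union_le _ _).trans (add_le_add hM ?_)
      refine (measure_union_le _ _).trans (add_le_add ?_ ?_)
      · exact (measure_union_le _ _).trans (add_le_add (hF _) (hF _))
      · refine (measure_union_le _ _).trans (add_le_add ?_ hR)
        exact (measure_union_le _ _).trans (add_le_add (hD _) (hD _))
    refine h1.trans ?_
    rw [← ENNReal.ofReal_add (by positivity) (by positivity),
      ← ENNReal.ofReal_add (by positivity) (by positivity),
      ← ENNReal.ofReal_add (by positivity) (by positivity),
      ← ENNReal.ofReal_add (by positivity) (by positivity),
      ← ENNReal.ofReal_add (by positivity) (by positivity)]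
    exact ENNReal.ofReal_le_ofReal (by linarith)
  have hmp := measurePreserving_markedSample P (α := α) 𝒜 n
  -- The adversary and the learner need not be measurable: the failure event is only included in the
  -- preimage of `B`, and outer measure suffices.
  refine (measure_mono ?_).trans ((Measure.le_map_apply hmp.aemeasurable B).trans
    (hmp.map_eq ▸ hB))
  intro ω hω
  by_contra hgood
  set s : Fin n → DataPoint X × Bool := fun i => (ω.1 i, ω.2.1 i)
  have hgood' : s ∉ B := hgood
  simp only [B, Set.mem_union, not_or] at hgood'
  obtain ⟨hMs, ⟨hF0, hF1⟩, ⟨hD0, hD1⟩, hRs⟩ := hgood'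
  have hS : ∀ i, (s i).2 = false → 𝒜.corrupted ω i = (s i).1 := fun i hi =>
    𝒜.corrupt_unmarked ω.1 ω.2.1 ω.2.2 i hi
  have hmarks : hits (markedPts X) s ≤ 3 / 2 * α * n := not_not.1 hMs
  have hcount : ∀ a, n * ((1 - α) * groupProb P a) / 2 ≤ hits (cleanGroup X a) s := by
    rintro (_ | _)
    · exact not_not.1 hF0
    · exact not_not.1 hF1
  have haccept : ∀ a, ∀ h ∈ H,
      |hits (cleanAccept h a) s - acceptRate P h a * hits (cleanGroup X a) s|
        ≤ 8 * parityErr d α p₀ δ n * hits (cleanGroup X a) s := by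
    intro a h hh
    by_contra hlt
    have hmem : s ∈ D a := ⟨hcount a, h, hh, not_le.1 hlt⟩
    rcases a with _ | _
    · exact hD0 hmem
    · exact hD1 hmem
  have hmiss : ∀ h ∈ H, |hits (misclassified h) s - risk P h * n| ≤ 2 * riskErr d δ n * n := by
    intro h hh
    by_contra hlt
    exact hRs ⟨h, hh, not_le.1 hlt⟩
  refine hω (hL.sub_le hH hstarH hopt (fun h hh => ?_) fun h hh => ?_)
  · exact abs_empRisk_sub_le hS hn0 h (hmiss h hh) hmarks
  · have hpar := abs_empParityDev_sub_le hS hn0 h hα hp₀ (q := acceptRate P h) hmarks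
      (fun a => ?_) fun a => haccept a h hh
    · refine hpar.trans (le_of_eq ?_)
      ring
    · refine le_trans ?_ (hcount a)
      -- Here `α < 1/2` is used: at least half of each group's mass stays unmarked, and the Chernoff
      -- bound halves it again to `p₀ / 4`.
      have h1 : p₀ / 2 ≤ (1 - α) * groupProb P a := by nlinarith [hgroup a]
      have hn' : (0 : ℝ) < n := by exact_mod_cast hn0
      nlinarith

end FairLearning

theorem theorem7 {X : Type*} [MeasurableSpace X] (H : Set (X → Bool)) (hH : H.Nonempty)
    (d : ℕ) (hd : FairLearning.vcDim H = d)
    (α p₀ δ : ℝ) (hα : 0 ≤ α) (hα' : α < 1 / 2) (hp₀ : 0 < p₀) (hp₀' : p₀ ≤ 1 / 2)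
    (hδ : 0 < δ) (hδ' : δ < 1) :
    (∃ L : FairLearning.Learner H, FairLearning.IsComponentWise H d α p₀ δ L) ∧
    ∀ L : FairLearning.Learner H, FairLearning.IsComponentWise H d α p₀ δ L →
    ∀ (P : Measure (FairLearning.DataPoint X)) [IsProbabilityMeasure P],
      FairLearning.groupProb P false = p₀ →
      FairLearning.RegularClass H (P.map Prod.fst) →
    ∀ hstar ∈ H,
      (∀ h ∈ H, FairLearning.risk P hstar ≤ FairLearning.risk P h ∧
        FairLearning.parityDev P hstar ≤ FairLearning.parityDev P h) →
    ∀ (𝒜 : FairLearning.MaliciousAdversary X) (n : ℕ),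
      max (max (8 * Real.log (16 / δ) / ((1 - α) * p₀)) (12 * Real.log (12 / δ) / α))
        ((d : ℝ) / 2) ≤ n →
      𝒜.law P α n
        {ω | ¬ (FairLearning.risk P (L n (𝒜.corrupted ω)) - FairLearning.risk P hstar
                ≤ 6 * α + 8 * FairLearning.riskErr d δ n ∧
              FairLearning.parityDev P (L n (𝒜.corrupted ω)) - FairLearning.parityDev P hstar
                ≤ 4 * FairLearning.deltaPar α p₀
                  + 64 * FairLearning.parityErr d α p₀ δ n)}
        ≤ ENNReal.ofReal δ := by
  refine ⟨FairLearning.exists_isComponentWise hH d α p₀ δ, ?_⟩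
  intro L hL P _ hP hreg hstar hstarH hopt 𝒜 n hn
  exact hL.measure_failure_le hH hd hα hα' hp₀ hp₀' hδ hδ' P hP hreg hstarH hopt 𝒜 hn
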